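/- **Theorem 2 (asymptotics of $J_B$ to all orders when $\sigma=1/2$).** Let $0<\delta<1$. For $t>0$ large put $\lambda_c=\dfrac{t^{\delta-1}}{1-t^{\delta-1}}$ and let $\lambda$ satisfy $\lambda_c\le\lambda\le t^{1-\delta}-1$. Let $F(z;\lambda)=(1-z)\ln(1-z)+z\ln z+z\ln\lambda$ with branch cuts $(-\infty,0]$ and $[1,\infty)$ (principal branches), and $$J_B(t;\lambda)=\int_{1-t^{\delta-1}}^{\infty e^{i\phi}}(1-z)^{-1/2}e^{itF(z;\lambda)}\,dz ,$$ where $0<\phi<\pi/2$ if $\ln\lambda\ge0$ and $0<\phi<\arctan(\pi/|\ln\lambda|)$ if $\ln\lambda<0$; the integral converges absolutely along the ray from $1-t^{\delta-1}$ in direction $e^{i\phi}$. Define $\Lambda$ by $\lambda=\lambda_c(1+\Lambda)$ and $\omega=\sqrt{\lambda_c t/2}\;\dfrac{\ln(1+\Lambda)}{1+\lambda_c}$. Let $m\ge4$ be a natural number, let $\epsilon>0$, and let $a=a(t)>0$ satisfy, as $t\to\infty$, $$t^{\epsilon-\frac{\delta}{2}+\frac{\delta}{4m+2}}\ll a\ll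 t^{-\frac{\delta}{2}+\frac{\delta}{4m-2}},$$ where $f\ll g$ means $f=O(g)$ (so the case $f=o(g)$ is included). Put $k=t^{\delta-1}(1-a)$ and, for $j\ge0$, $$T_j(t;\lambda)=-\left[\left(\frac{-1}{it\,\partial F/\partial z}\cdot\frac{\partial}{\partial z}\right)^{j}\left(\frac{(1-z)^{-1/2}}{it\,\partial F/\partial z}\right)\right]e^{itF(z;\lambda)}\Bigg|_{z=1-k}.$$ Then, as $t\to\infty$, $$J_B(t;\lambda)=\sum_{j=0}^{m-3}T_j(t;\lambda)+e^{itF(1-t^{\delta-1};\lambda)-i\omega^2}\,t^{-1/2}\sqrt{\frac{2}{1+\lambda_c}}\int_{\omega}^{\omega+a\sqrt{\lambda_c t/2}}e^{i\xi^2}\,d\xi$$ $$\qquad+O\!\left((4m-5)!!\,t^{-\frac12-\frac{(4m-5)\delta}{2}}(\ln t)^{\frac{4m-3}{2}}a^{-4m+4}\right)+O\!\left(t^{-\frac12+\frac{3\delta}{2}}a^4\right),$$ and, for each $0\le j\le m-3$, $$T_j(t;\lambda)=O\!\left((2j-1)!!\,t^{-\frac12-\frac{(2j+1)\delta}{2}}a^{-2j-1}\right),\qquad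 (-1)!!:=1.$$ The implied constants depend only on $\delta$; the bounds hold for all $t\ge t_0$, where $t_0$ may depend on $\delta$, $m$, $\epsilon$ and the function $a$. Neither the constants nor $t_0$ depend on $\lambda$ or $\phi$. -/

import Mathlib

open Filter Asymptotics MeasureTheory

noncomputable section

namespace JBAsymptotics

/-- The phase `F(z;λ) = (1-z) ln(1-z) + z ln z + z ln λ`. With the principal branch of the
logarithm its cuts are `(-∞,0]` and `[1,∞)`. -/
def F (z : ℂ) (lam : ℝ) : ℂ :=
  (1 - z) * Complex.log (1 - z) + z * Complex.log z + z * (Real.log lam : ℂ)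

/-- The integrand `(1-z)^(-1/2) z^(σ-1/2) exp(i t F(z;λ))`. -/
def integrand (σ t lam : ℝ) (z : ℂ) : ℂ :=
  (1 - z) ^ (-(1 / 2) : ℂ) * z ^ ((σ : ℂ) - 1 / 2) * Complex.exp (Complex.I * t * F z lam)

/-- The endpoint `1 - t^(δ-1)`. -/
def z₀ (δ t : ℝ) : ℝ := 1 - t ^ (δ - 1)

/-- The directions `φ` along which the contour may go to infinity. -/
def AdmissibleAngle (lam φ : ℝ) : Prop :=
  0 < φ ∧ (0 ≤ Real.log lam → φ < Real.pi / 2) ∧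
    (Real.log lam < 0 → φ < Real.arctan (Real.pi / |Real.log lam|))

/-- The integrand of `J_B` pulled back to the ray `z = 1 - t^(δ-1) + R e^{iφ}`, `R > 0`,
including the Jacobian `dz/dR = e^{iφ}`. -/
def rayIntegrand (δ σ t lam φ R : ℝ) : ℂ :=
  integrand σ t lam ((z₀ δ t : ℂ) + R * Complex.exp (Complex.I * φ)) *
    Complex.exp (Complex.I * φ)

/-- `J_B(t;λ,δ,σ)`, the integral of `integrand` from `1 - t^(δ-1)` to `∞ e^{iφ}`. -/
def JB (δ σ t lam φ : ℝ) : ℂ :=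
  ∫ R in Set.Ioi (0 : ℝ), rayIntegrand δ σ t lam φ R

/-- The critical value `λ_c = t^(δ-1) / (1 - t^(δ-1))`. -/
def lamC (δ t : ℝ) : ℝ := t ^ (δ - 1) / (1 - t ^ (δ - 1))

/-- `Λ`, given by `λ = λ_c (1 + Λ)`. -/
def bigLam (δ t lam : ℝ) : ℝ := lam / lamC δ t - 1

/-- `ω = √(λ_c t / 2) · ln(1 + Λ) / (1 + λ_c)`. -/
def omega (δ t lam : ℝ) : ℝ :=
  Real.sqrt (lamC δ t * t / 2) * (Real.log (1 + bigLam δ t lam) / (1 + lamC δ t))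

/-- The splitting parameter `k = t^(δ-1) (1 - a)`. -/
def splitK (δ t a : ℝ) : ℝ := t ^ (δ - 1) * (1 - a)

/-- `∂F/∂z`. -/
def dF (lam : ℝ) (z : ℂ) : ℂ := deriv (fun w => F w lam) z

/-- The operator `(-1 / (i t ∂F/∂z)) · ∂/∂z`. -/
def ibpOp (t lam : ℝ) (h : ℂ → ℂ) : ℂ → ℂ :=
  fun z => -1 / (Complex.I * t * dF lam z) * deriv h z

/-- The function `(1-z)^(-1/2) / (i t ∂F/∂z)`. -/
def ibpStart (t lam : ℝ) : ℂ → ℂ :=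
  fun z => (1 - z) ^ (-(1 / 2) : ℂ) / (Complex.I * t * dF lam z)

/-- The boundary term `T_j(t;λ)`: minus the `j`-th power of `ibpOp` applied to `ibpStart`,
times `exp(i t F)`, at `z = 1 - k`. -/
def T (t lam k : ℝ) (j : ℕ) : ℂ :=
  -((ibpOp t lam)^[j] (ibpStart t lam) (1 - (k : ℂ))) *
    Complex.exp (Complex.I * t * F (1 - (k : ℂ)) lam)

/-- The truncated Fresnel term
`exp(i t F(1 - t^(δ-1);λ) - i ω²) t^(-1/2) √(2/(1+λ_c)) ∫_ω^{ω + a √(λ_c t/2)} e^{iξ²} dξ`. -/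
def fresnelTerm (δ t lam a : ℝ) : ℂ :=
  Complex.exp (Complex.I * t * F (z₀ δ t : ℂ) lam - Complex.I * (omega δ t lam : ℂ) ^ 2) *
    ((t ^ (-(1 / 2) : ℝ) * Real.sqrt (2 / (1 + lamC δ t)) : ℝ) : ℂ) *
    ∫ ξ in (omega δ t lam)..(omega δ t lam + a * Real.sqrt (lamC δ t * t / 2)),
      Complex.exp (Complex.I * (ξ : ℂ) ^ 2)

/-- `(4m-5)!! t^(-1/2-(4m-5)δ/2) (ln t)^((4m-3)/2) a^(-4m+4)`. -/
def err₁ (δ : ℝ) (m : ℕ) (t a : ℝ) : ℝ :=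
  (Nat.doubleFactorial (4 * m - 5) : ℝ) * t ^ (-(1 / 2) - (4 * (m : ℝ) - 5) * δ / 2) *
    Real.log t ^ ((4 * (m : ℝ) - 3) / 2) * a ^ (-(4 * (m : ℝ)) + 4)

/-- `t^(-1/2+3δ/2) a^4`. -/
def err₂ (δ t a : ℝ) : ℝ := t ^ (-(1 / 2) + 3 * δ / 2) * a ^ 4

/-- `(2j-1)!! t^(-1/2-(2j+1)δ/2) a^(-2j-1)`, where `(-1)!! = 1` (in Lean: `0‼ = 1`). -/
def boundT (δ : ℝ) (j : ℕ) (t a : ℝ) : ℝ :=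
  (Nat.doubleFactorial (2 * j - 1) : ℝ) * t ^ (-(1 / 2) - (2 * (j : ℝ) + 1) * δ / 2) *
    a ^ (-(2 * (j : ℝ)) - 1)

end JBAsymptotics

end

namespace JBAsymptotics

/-! Put `p = t^(δ-1)` and `y = a t^(δ/2)`, so that `y² = t p a²`. A primitive `g` of the integrand
on a convex wedge of the cut plane splits `J_B` at `1 - k = 1 - p + p a` into a real segment and a
tail, and lets the tail be taken along another ray.

On the segment, with `z = 1 - p + p s` and `0 ≤ s ≤ a`, the phase is expanded to second order in
`s`. Completing the square gives exactly the Fresnel term. The cubic remainder `O(t p s³)` and the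
amplitude error `O(s)`, integrated against `√p ds`, give `err₂`, because `y ≥ 1`
(`norm_near_sub_fresnelTerm_le`).

The tail runs along the ray from `1 - k` of slope `η = 1 / ln t`. Since `λ ≥ λ_c`, `|F'| ≥ a` on the
whole ray (`le_norm_dF_slantRay`), and `η ln λ ≥ -1` makes the exponential decay there
(`norm_exp_phase_slantRay_le`). Repeated integration by parts has a closed form
(`iterate_ibpOp_eq`): `(1-z)^(-1/2) (z(1-z))^(-j)` times a polynomial in `1/F'` whose top power
`(F')^(-(2j+1))` has coefficient `±(2j-1)!!`. At `1 - k` each step therefore gains `y^(-2)`, which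
bounds `T_j` with the right double factorial. Along the ray the lower bound for `|1-z|` is only
`ηk/2`, which costs powers of `ln t`.

That loss is repaid by integrating by parts `N` times with `N` far beyond `m - 2`. As `y ≥ t^γ` with
`γ = δ/(4m+2)`, the crude remainder falls below `t^(-1/2) y^(-(2m-3))`, and the surplus `T_j` have
the same size up to a constant. The upper bound on `a` gives `y^(2m-1) = O(t^(δ/2))`, hence
`y^(-(2m-3)) = O(t^(δ/2) y^(-(4m-4)))`, the power in `err₁`. The logarithm in `err₁` absorbs all
constants depending on `m` and `a`, so the final constant is absolute. -/

/-! ### Coefficient polynomials of the iterated integration by parts -/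

open Polynomial in
/-- The coefficients of the powers of `(∂F/∂z)⁻¹` in the iterates of `ibpOp`. -/
noncomputable def ibpCoeff : ℕ → ℕ → Polynomial ℂ
  | 0, 0 => 1
  | 0, _ + 1 => 0
  | j + 1, 0 => (C (1 / 2) * X - C (j : ℂ) * (1 - 2 * X)) * ibpCoeff j 0
      + X * (1 - X) * derivative (ibpCoeff j 0)
  | j + 1, l + 1 => (C (1 / 2) * X - C (j : ℂ) * (1 - 2 * X)) * ibpCoeff j (l + 1)
      + X * (1 - X) * derivative (ibpCoeff j (l + 1)) - C ((j : ℂ) + 1 + l) * ibpCoeff j l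

theorem ibpCoeff_eq_zero {j l : ℕ} (h : j < l) : ibpCoeff j l = 0 := by
  induction j generalizing l with
  | zero => cases l with
    | zero => omega
    | succ l => rfl
  | succ j ih => cases l with
    | zero => omega
    | succ l => simp [ibpCoeff, ih (show j < l + 1 by omega), ih (show j < l by omega)]

theorem ibpCoeff_self (j : ℕ) :
    ibpCoeff j j = Polynomial.C ((-1) ^ j * (Nat.doubleFactorial (2 * j - 1) : ℂ)) := by
  induction j with
  | zero => simp [ibpCoeff]
  | succ j ih =>
    -- At `j = 0` the truncated `2 * 0 - 1 = 0` gives `0‼ = 1`, matching the convention `(-1)!! =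
    -- 1`.
    have h : Nat.doubleFactorial (2 * (j + 1) - 1) = (2 * j + 1) * Nat.doubleFactorial (2 * j - 1) := by
      cases j with
      | zero => rfl
      | succ j =>
        rw [show 2 * (j + 1 + 1) - 1 = (2 * j + 1) + 2 by omega, Nat.doubleFactorial_add_two,
          show 2 * (j + 1) - 1 = 2 * j + 1 by omega]
        ring
    rw [ibpCoeff, ibpCoeff_eq_zero (Nat.lt_succ_self j), ih, h]
    simp only [mul_zero, Polynomial.derivative_zero, zero_add, zero_sub, ← Polynomial.C_mul,
      ← Polynomial.C_neg]
    congr 1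
    push_cast
    ring

theorem natDegree_ibpStep_le {p q : Polynomial ℂ} {j : ℕ} (c : ℂ) (hp : p.natDegree ≤ j)
    (hq : q.natDegree ≤ j) :
    ((Polynomial.C (1 / 2) * Polynomial.X - Polynomial.C (j : ℂ) * (1 - 2 * Polynomial.X)) * p
      + Polynomial.X * (1 - Polynomial.X) * Polynomial.derivative p
      - Polynomial.C c * q).natDegree ≤ j + 1 := by
  refine (Polynomial.natDegree_sub_le _ _).trans (max_le ?_ ?_)
  · refine (Polynomial.natDegree_add_le _ _).trans (max_le ?_ ?_)
    · refine Polynomial.natDegree_mul_le.trans ?_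
      have : (Polynomial.C (1 / 2 : ℂ) * Polynomial.X
          - Polynomial.C (j : ℂ) * (1 - 2 * Polynomial.X)).natDegree ≤ 1 := by
        compute_degree
      omega
    · by_cases h0 : p.natDegree = 0
      · rw [Polynomial.derivative_of_natDegree_zero h0]; simp
      · refine Polynomial.natDegree_mul_le.trans ?_
        have h2 := Polynomial.natDegree_derivative_lt h0
        have : (Polynomial.X * (1 - Polynomial.X) : Polynomial ℂ).natDegree ≤ 2 := by
          compute_degree
        omega
  · exact (Polynomial.natDegree_C_mul_le _ _).trans (hq.trans (Nat.le_succ j))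

/-- This degree bound lets the factor `z^(-j)` of the iterates absorb the polynomial when `|z| ≥
1/2`, so that only `(1-z)^(-j)` is left. -/
theorem natDegree_ibpCoeff_le (j l : ℕ) : (ibpCoeff j l).natDegree ≤ j := by
  induction j generalizing l with
  | zero => cases l <;> simp [ibpCoeff]
  | succ j ih => cases l with
    | zero => simpa [ibpCoeff] using natDegree_ibpStep_le 0 (ih 0) (ih 0)
    | succ l => simpa [ibpCoeff] using natDegree_ibpStep_le ((j : ℂ) + 1 + l) (ih (l + 1)) (ih l)

theorem exists_norm_ibpCoeff_le (j l : ℕ) :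
    ∃ K : ℝ, 0 ≤ K ∧ ∀ z : ℂ, 1 / 2 ≤ ‖z‖ → ‖(ibpCoeff j l).eval z‖ ≤ K * ‖z‖ ^ j := by
  refine ⟨∑ i ∈ Finset.range (j + 1), ‖(ibpCoeff j l).coeff i‖ * 2 ^ j, by positivity,
    fun z hz => ?_⟩
  rw [Polynomial.eval_eq_sum_range' (Nat.lt_succ_of_le (natDegree_ibpCoeff_le j l)),
    Finset.sum_mul]
  refine (norm_sum_le _ _).trans (Finset.sum_le_sum fun i hi => ?_)
  rw [norm_mul, norm_pow, mul_assoc, ← mul_pow]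
  refine mul_le_mul_of_nonneg_left ?_ (norm_nonneg _)
  calc ‖z‖ ^ i ≤ (2 * ‖z‖) ^ i := by gcongr; linarith [norm_nonneg z]
    _ ≤ (2 * ‖z‖) ^ j :=
      pow_le_pow_right₀ (by linarith) (Nat.lt_succ_iff.1 (Finset.mem_range.1 hi))

/-! ### The phase on the cut plane -/

/-- The plane cut along `(-∞,0]` and `[1,∞)`. -/
def cutPlane : Set ℂ := {z | z ∈ Complex.slitPlane ∧ 1 - z ∈ Complex.slitPlane}

theorem isOpen_cutPlane : IsOpen cutPlane :=
  Complex.isOpen_slitPlane.inter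
    (Complex.isOpen_slitPlane.preimage (continuous_const.sub continuous_id))

theorem ne_zero_of_mem_cutPlane {z : ℂ} (hz : z ∈ cutPlane) : z ≠ 0 := Complex.slitPlane_ne_zero hz.1

theorem one_sub_ne_zero_of_mem_cutPlane {z : ℂ} (hz : z ∈ cutPlane) : 1 - z ≠ 0 :=
  Complex.slitPlane_ne_zero hz.2

theorem hasDerivAt_one_sub (z : ℂ) : HasDerivAt (fun w : ℂ => 1 - w) (-1) z := by
  simpa using (hasDerivAt_id z).const_sub 1

theorem hasDerivAt_log_one_sub {z : ℂ} (hz : z ∈ cutPlane) :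
    HasDerivAt (fun w => Complex.log (1 - w)) (-(1 - z)⁻¹) z := by
  simpa [div_eq_mul_inv] using (hasDerivAt_one_sub z).clog hz.2

theorem hasDerivAt_F_log {z : ℂ} (hz : z ∈ cutPlane) (lam : ℝ) :
    HasDerivAt (fun w => F w lam)
      (Complex.log z - Complex.log (1 - z) + (Real.log lam : ℂ)) z := by
  have h0 := (ne_zero_of_mem_cutPlane hz)
  have h1 := (one_sub_ne_zero_of_mem_cutPlane hz)
  have := (((hasDerivAt_one_sub z).mul (hasDerivAt_log_one_sub hz)).add
    ((hasDerivAt_id z).mul (Complex.hasDerivAt_log hz.1))).add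
    ((hasDerivAt_id z).mul_const (Real.log lam : ℂ))
  refine this.congr_deriv ?_
  simp only [id]
  field_simp
  ring

theorem dF_eq {z : ℂ} (hz : z ∈ cutPlane) (lam : ℝ) :
    dF lam z = Complex.log z - Complex.log (1 - z) + (Real.log lam : ℂ) :=
  (hasDerivAt_F_log hz lam).deriv

theorem hasDerivAt_F {z : ℂ} (hz : z ∈ cutPlane) (lam : ℝ) :
    HasDerivAt (fun w => F w lam) (dF lam z) z := by
  rw [dF_eq hz]; exact hasDerivAt_F_log hz lam

theorem hasDerivAt_dF {z : ℂ} (hz : z ∈ cutPlane) (lam : ℝ) :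
    HasDerivAt (dF lam) (z * (1 - z))⁻¹ z := by
  have h0 := (ne_zero_of_mem_cutPlane hz)
  have h1 := (one_sub_ne_zero_of_mem_cutPlane hz)
  have h : HasDerivAt (dF lam) (z⁻¹ - -(1 - z)⁻¹) z :=
    (((Complex.hasDerivAt_log hz.1).sub (hasDerivAt_log_one_sub hz)).add_const
      (Real.log lam : ℂ)).congr_of_eventuallyEq
      (Filter.eventuallyEq_of_mem (isOpen_cutPlane.mem_nhds hz) fun w hw => dF_eq hw lam)
  refine h.congr_deriv ?_
  field_simp
  ring

/-- The cut plane without the stationary point of the phase. -/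
def regularSet (lam : ℝ) : Set ℂ := {z | z ∈ cutPlane ∧ dF lam z ≠ 0}

theorem regularSet_mem_nhds {lam : ℝ} {z : ℂ} (hz : z ∈ regularSet lam) :
    regularSet lam ∈ nhds z :=
  Filter.inter_mem (isOpen_cutPlane.mem_nhds hz.1)
    ((hasDerivAt_dF hz.1 lam).continuousAt.eventually_ne hz.2)

/-! ### Closed form of the iterated integration by parts -/

/-- The sum over powers of `(∂F/∂z)⁻¹` occurring in the iterates of `ibpOp`. -/
noncomputable def ibpSum (lam : ℝ) (j : ℕ) (z : ℂ) : ℂ :=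
  ∑ l ∈ Finset.range (j + 1), (ibpCoeff j l).eval z * (dF lam z)⁻¹ ^ (j + 1 + l)

/-- The iterates of `ibpOp`, up to a power of `t`. -/
noncomputable def ibpClosed (lam : ℝ) (j : ℕ) (z : ℂ) : ℂ :=
  (1 - z) ^ (-(1 / 2) : ℂ) * (z * (1 - z))⁻¹ ^ j * ibpSum lam j z

theorem hasDerivAt_one_sub_cpow {z : ℂ} (hz : z ∈ cutPlane) :
    HasDerivAt (fun w : ℂ => (1 - w) ^ (-(1 / 2) : ℂ))
      (1 / 2 * (1 - z)⁻¹ * (1 - z) ^ (-(1 / 2) : ℂ)) z := by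
  have h := (hasDerivAt_one_sub z).cpow_const (c := (-(1 / 2) : ℂ)) hz.2
  refine h.congr_deriv ?_
  rw [Complex.cpow_sub _ _ (one_sub_ne_zero_of_mem_cutPlane hz), Complex.cpow_one]
  field_simp [(one_sub_ne_zero_of_mem_cutPlane hz)]

theorem hasDerivAt_inv_dF {lam : ℝ} {z : ℂ} (hz : z ∈ regularSet lam) :
    HasDerivAt (fun w => (dF lam w)⁻¹) (-(z * (1 - z))⁻¹ * (dF lam z)⁻¹ ^ 2) z := by
  refine ((hasDerivAt_dF hz.1 lam).inv hz.2).congr_deriv ?_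
  rw [div_eq_mul_inv, inv_pow]

theorem hasDerivAt_ibpSum {lam : ℝ} {z : ℂ} (hz : z ∈ regularSet lam) (j : ℕ) :
    HasDerivAt (ibpSum lam j)
      (∑ l ∈ Finset.range (j + 1), ((ibpCoeff j l).derivative.eval z * (dF lam z)⁻¹ ^ (j + 1 + l)
        - (z * (1 - z))⁻¹ * ((j + 1 + l : ℂ) * (ibpCoeff j l).eval z
          * (dF lam z)⁻¹ ^ (j + 1 + l + 1)))) z := by
  unfold ibpSum
  refine HasDerivAt.fun_sum fun l _ => ?_
  refine (((ibpCoeff j l).hasDerivAt z).mul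
    ((hasDerivAt_inv_dF hz).pow (j + 1 + l))).congr_deriv ?_
  rw [show j + 1 + l - 1 = j + l by omega, Pi.pow_apply]
  push_cast
  ring

/-- The recursion for `ibpCoeff`, read off from the product rule. After extracting `(z(1-z))⁻¹`, the
factor `(1-z)^(-1/2)` contributes `z/2`, the factor `(z(1-z))^(-j)` contributes `-j(1-2z)`, and
differentiating a power of `1/F'` raises `l` by one because `F'' = (z(1-z))⁻¹`. -/
theorem ibpSum_succ {lam : ℝ} {z : ℂ} (j : ℕ) (hz : z * (1 - z) ≠ 0) :
    ibpSum lam (j + 1) z = (dF lam z)⁻¹ * ((z / 2 - j * (1 - 2 * z)) * ibpSum lam j z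
      + z * (1 - z) * ∑ l ∈ Finset.range (j + 1),
        ((ibpCoeff j l).derivative.eval z * (dF lam z)⁻¹ ^ (j + 1 + l)
        - (z * (1 - z))⁻¹ * ((j + 1 + l : ℂ) * (ibpCoeff j l).eval z
          * (dF lam z)⁻¹ ^ (j + 1 + l + 1)))) := by
  set v := (dF lam z)⁻¹ with hv
  set A : ℕ → ℂ := fun l => (z / 2 - j * (1 - 2 * z)) * (ibpCoeff j l).eval z
    + z * (1 - z) * (ibpCoeff j l).derivative.eval z with hA
  have hR : v * ((z / 2 - j * (1 - 2 * z)) * ibpSum lam j z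
      + z * (1 - z) * ∑ l ∈ Finset.range (j + 1),
        ((ibpCoeff j l).derivative.eval z * v ^ (j + 1 + l)
        - (z * (1 - z))⁻¹ * ((j + 1 + l : ℂ) * (ibpCoeff j l).eval z * v ^ (j + 1 + l + 1))))
      = ∑ l ∈ Finset.range (j + 1), A l * v ^ (j + 1 + 1 + l)
        - ∑ l ∈ Finset.range (j + 1),
          (j + 1 + l : ℂ) * (ibpCoeff j l).eval z * v ^ (j + 1 + 1 + (l + 1)) := by
    rw [ibpSum, ← hv, Finset.mul_sum, Finset.mul_sum, ← Finset.sum_add_distrib, Finset.mul_sum,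
      ← Finset.sum_sub_distrib]
    refine Finset.sum_congr rfl fun l _ => ?_
    have h1 : z * (1 - z) * ((ibpCoeff j l).derivative.eval z * v ^ (j + 1 + l)
        - (z * (1 - z))⁻¹ * ((j + 1 + l : ℂ) * (ibpCoeff j l).eval z * v ^ (j + 1 + l + 1)))
        = z * (1 - z) * (ibpCoeff j l).derivative.eval z * v ^ (j + 1 + l)
        - (j + 1 + l : ℂ) * (ibpCoeff j l).eval z * v ^ (j + 1 + l + 1) := by
      rw [mul_sub, mul_inv_cancel_left₀ hz]; ring
    rw [h1, hA]
    ring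
  rw [hR]
  -- The two sums run over `l` and `l + 1`. Adding the vanishing term at `j + 1` and peeling off `l
  -- = 0` aligns them.
  have hlast : A (j + 1) = 0 := by simp [hA, ibpCoeff_eq_zero (Nat.lt_succ_self j)]
  have h2 : ∑ l ∈ Finset.range (j + 1), A l * v ^ (j + 1 + 1 + l)
      = ∑ l ∈ Finset.range (j + 1), A (l + 1) * v ^ (j + 1 + 1 + (l + 1))
        + A 0 * v ^ (j + 1 + 1 + 0) := by
    rw [← Finset.sum_range_succ' (fun l => A l * v ^ (j + 1 + 1 + l)), Finset.sum_range_succ _ (j + 1),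
      hlast, zero_mul, add_zero]
  rw [h2, ibpSum, ← hv, Finset.sum_range_succ', add_sub_right_comm, ← Finset.sum_sub_distrib]
  congr 1
  · refine Finset.sum_congr rfl fun l _ => ?_
    simp only [ibpCoeff, hA, Polynomial.eval_sub, Polynomial.eval_add, Polynomial.eval_mul,
      Polynomial.eval_C, Polynomial.eval_X, Polynomial.eval_one, Polynomial.eval_ofNat]
    ring
  · simp only [ibpCoeff, hA, Polynomial.eval_sub, Polynomial.eval_add, Polynomial.eval_mul,
      Polynomial.eval_C, Polynomial.eval_X, Polynomial.eval_one, Polynomial.eval_ofNat]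
    ring

theorem hasDerivAt_ibpClosed {lam : ℝ} {z : ℂ} (hz : z ∈ regularSet lam) (j : ℕ) :
    HasDerivAt (ibpClosed lam j) (dF lam z * ibpClosed lam (j + 1) z) z := by
  have h0 := (ne_zero_of_mem_cutPlane hz.1)
  have h1 := (one_sub_ne_zero_of_mem_cutPlane hz.1)
  have hQ : HasDerivAt (fun w : ℂ => (w * (1 - w))⁻¹) (-(z * (1 - z))⁻¹ ^ 2 * (1 - 2 * z)) z := by
    refine (((hasDerivAt_id z).mul (hasDerivAt_one_sub z)).inv (mul_ne_zero h0 h1)).congr_deriv ?_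
    simp only [id, Pi.mul_apply]
    field_simp
    ring
  refine (((hasDerivAt_one_sub_cpow hz.1).mul (hQ.pow j)).mul
    (hasDerivAt_ibpSum hz j)).congr_deriv ?_
  rw [ibpClosed, ibpSum_succ j (mul_ne_zero h0 h1)]
  have hj : (j : ℂ) * (z * (1 - z))⁻¹ ^ (j - 1) * (-(z * (1 - z))⁻¹ ^ 2 * (1 - 2 * z))
      = -(j : ℂ) * (z * (1 - z))⁻¹ ^ (j + 1) * (1 - 2 * z) := by
    cases j with
    | zero => simp
    | succ j => simp only [Nat.add_sub_cancel]; ring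
  have hq : (z * (1 - z))⁻¹ * (z * (1 - z)) = 1 := inv_mul_cancel₀ (mul_ne_zero h0 h1)
  have hi : (1 - z)⁻¹ = z * (z * (1 - z))⁻¹ := by field_simp
  simp only [Pi.mul_apply, Pi.pow_apply]
  rw [hj, hi]
  set v := (z * (1 - z))⁻¹
  set S := ∑ l ∈ Finset.range (j + 1),
    ((ibpCoeff j l).derivative.eval z * (dF lam z)⁻¹ ^ (j + 1 + l)
        - v * ((j + 1 + l : ℂ) * (ibpCoeff j l).eval z * (dF lam z)⁻¹ ^ (j + 1 + l + 1)))
  have hw : dF lam z * (dF lam z)⁻¹ = 1 := mul_inv_cancel₀ hz.2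
  linear_combination (-(1 - z) ^ (-(1 / 2) : ℂ) * v ^ j * S) * hq
    - ((1 - z) ^ (-(1 / 2) : ℂ) * v ^ (j + 1) * ((z / 2 - j * (1 - 2 * z)) * ibpSum lam j z
      + z * (1 - z) * S)) * hw

theorem iterate_ibpOp_eq {t lam : ℝ} (ht : t ≠ 0) (j : ℕ) {z : ℂ} (hz : z ∈ regularSet lam) :
    (ibpOp t lam)^[j] (ibpStart t lam) z
      = (-1) ^ j * ((Complex.I * t)⁻¹) ^ (j + 1) * ibpClosed lam j z := by
  have hIt : Complex.I * (t : ℂ) ≠ 0 :=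
    mul_ne_zero Complex.I_ne_zero (Complex.ofReal_ne_zero.2 ht)
  induction j generalizing z with
  | zero =>
    simp only [ibpStart, ibpClosed, ibpSum, ibpCoeff, Function.iterate_zero, id, div_eq_mul_inv,
      mul_inv, pow_zero, zero_add, pow_one, Finset.sum_range_one, Polynomial.eval_one, add_zero]
    ring
  | succ j ih =>
    rw [Function.iterate_succ_apply', ibpOp,
      (Filter.eventuallyEq_of_mem (regularSet_mem_nhds hz) fun w hw => ih hw).deriv_eq,
      ((hasDerivAt_ibpClosed hz j).const_mul _).deriv]
    rw [div_eq_mul_inv, mul_inv]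
    linear_combination (-(-1) ^ j * (Complex.I * (t : ℂ))⁻¹ ^ (j + 2) * ibpClosed lam (j + 1) z)
      * inv_mul_cancel₀ hz.2

theorem hasDerivAt_iterate_ibpOp {t lam : ℝ} (ht : t ≠ 0) (j : ℕ) {z : ℂ}
    (hz : z ∈ regularSet lam) :
    HasDerivAt ((ibpOp t lam)^[j] (ibpStart t lam))
      (-(Complex.I * t * dF lam z) * (ibpOp t lam)^[j + 1] (ibpStart t lam) z) z := by
  have hIt : Complex.I * (t : ℂ) ≠ 0 :=
    mul_ne_zero Complex.I_ne_zero (Complex.ofReal_ne_zero.2 ht)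
  refine (((hasDerivAt_ibpClosed hz j).const_mul
    ((-1) ^ j * ((Complex.I * t)⁻¹) ^ (j + 1))).congr_of_eventuallyEq
    (Filter.eventuallyEq_of_mem (regularSet_mem_nhds hz)
      fun w hw => iterate_ibpOp_eq ht j hw)).congr_deriv ?_
  rw [iterate_ibpOp_eq ht (j + 1) hz]
  linear_combination (-((-1) ^ j * (Complex.I * (t : ℂ))⁻¹ ^ (j + 1) * dF lam z
    * ibpClosed lam (j + 1) z)) * mul_inv_cancel₀ hIt

theorem hasDerivAt_exp_phase {z : ℂ} (hz : z ∈ cutPlane) (t lam : ℝ) :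
    HasDerivAt (fun w => Complex.exp (Complex.I * t * F w lam))
      (Complex.I * t * dF lam z * Complex.exp (Complex.I * t * F z lam)) z := by
  refine ((hasDerivAt_F hz lam).const_mul (Complex.I * (t : ℂ))).cexp.congr_deriv ?_
  ring

/-- Repeated integration by parts in differential form. -/
theorem hasDerivAt_sum_ibp {t lam : ℝ} (ht : t ≠ 0) (N : ℕ) {z : ℂ} (hz : z ∈ regularSet lam) :
    HasDerivAt (fun w => (∑ j ∈ Finset.range N, (ibpOp t lam)^[j] (ibpStart t lam) w)
        * Complex.exp (Complex.I * t * F w lam))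
      ((1 - z) ^ (-(1 / 2) : ℂ) * Complex.exp (Complex.I * t * F z lam)
        - (ibpOp t lam)^[N] (ibpStart t lam) z * (Complex.I * t * dF lam z)
          * Complex.exp (Complex.I * t * F z lam)) z := by
  have hIt : Complex.I * (t : ℂ) ≠ 0 :=
    mul_ne_zero Complex.I_ne_zero (Complex.ofReal_ne_zero.2 ht)
  refine ((HasDerivAt.fun_sum fun j (_ : j ∈ Finset.range N) =>
    hasDerivAt_iterate_ibpOp ht j hz).mul (hasDerivAt_exp_phase hz.1 t lam)).congr_deriv ?_
  have h0 : (1 - z) ^ (-(1 / 2) : ℂ) = ibpStart t lam z * (Complex.I * t * dF lam z) := by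
    rw [ibpStart, div_mul_cancel₀ _ (mul_ne_zero hIt hz.2)]
  -- Each iterate differentiates to minus `i t F'` times the next one, so the sum telescopes to the
  -- first minus the last.
  have h1 := Finset.sum_range_sub' (fun j => (ibpOp t lam)^[j] (ibpStart t lam) z) N
  rw [Finset.sum_sub_distrib] at h1
  simp only [Function.iterate_zero, id] at h1
  rw [h0, ← Finset.mul_sum]
  linear_combination (Complex.I * t * dF lam z * Complex.exp (Complex.I * t * F z lam)) * h1

/-! ### Bounds for the iterates -/

theorem norm_inv_mul_ibpCoeff_le {j l : ℕ} {K : ℝ}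
    (hK : ∀ z : ℂ, 1 / 2 ≤ ‖z‖ → ‖(ibpCoeff j l).eval z‖ ≤ K * ‖z‖ ^ j) {z : ℂ}
    (hz : 1 / 2 ≤ ‖z‖) :
    ‖(z * (1 - z))⁻¹ ^ j‖ * ‖(ibpCoeff j l).eval z‖ ≤ K * ‖1 - z‖⁻¹ ^ j := by
  have hz0 : 0 < ‖z‖ := by linarith
  calc _ ≤ ‖(z * (1 - z))⁻¹ ^ j‖ * (K * ‖z‖ ^ j) := by gcongr; exact hK z hz
    _ = K * ‖1 - z‖⁻¹ ^ j * (‖z‖⁻¹ * ‖z‖) ^ j := by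
      rw [norm_pow, norm_inv, norm_mul, mul_inv]; ring
    _ = _ := by rw [inv_mul_cancel₀ hz0.ne', one_pow, mul_one]

theorem norm_one_sub_cpow_neg_half (z : ℂ) :
    ‖(1 - z) ^ (-(1 / 2) : ℂ)‖ = ‖1 - z‖ ^ (-(1 / 2) : ℝ) := by
  rw [show (-(1 / 2) : ℂ) = ((-(1 / 2) : ℝ) : ℂ) by push_cast; rfl,
    Complex.norm_cpow_real]

/-- The factor `1 + ‖dF lam z‖` serves two uses at once: the iterate alone in the boundary terms,
and the iterate times `F'` in the remainder integral. Multiplying by `F'` only lowers the power of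
`1/F'`, so the exponent `2j + 1` still suffices for `b ≤ 1`. -/
theorem exists_norm_ibpClosed_le (j : ℕ) : ∃ K : ℝ, 0 ≤ K ∧ ∀ (lam b : ℝ) (z : ℂ),
    z ∈ cutPlane → 1 / 2 ≤ ‖z‖ → 0 < b → b ≤ 1 → b ≤ ‖dF lam z‖ →
    ‖ibpClosed lam j z‖ * (1 + ‖dF lam z‖)
      ≤ K * ‖1 - z‖ ^ (-(1 / 2) : ℝ) * ‖1 - z‖⁻¹ ^ j * b⁻¹ ^ (2 * j + 1) := by
  choose K hK0 hK using exists_norm_ibpCoeff_le j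
  refine ⟨∑ l ∈ Finset.range (j + 1), 2 * K l, Finset.sum_nonneg fun l _ => by
    linarith [hK0 l], fun lam b z hz hz2 hb hb1 hbw => ?_⟩
  have hw : 0 < ‖dF lam z‖ := hb.trans_le hbw
  have hbi : 1 ≤ b⁻¹ := (one_le_inv₀ hb).2 hb1
  have hterm : ∀ l ∈ Finset.range (j + 1),
      ‖(z * (1 - z))⁻¹ ^ j‖ * ‖(ibpCoeff j l).eval z * (dF lam z)⁻¹ ^ (j + 1 + l)‖
        * (1 + ‖dF lam z‖) ≤ 2 * K l * ‖1 - z‖⁻¹ ^ j * b⁻¹ ^ (2 * j + 1) := by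
    intro l hl
    have hl' := Finset.mem_range.1 hl
    have h1 : ‖dF lam z‖⁻¹ ^ (j + 1 + l) * (1 + ‖dF lam z‖) ≤ 2 * b⁻¹ ^ (2 * j + 1) := by
      have e : ‖dF lam z‖⁻¹ ^ (j + 1 + l) * (1 + ‖dF lam z‖)
          = ‖dF lam z‖⁻¹ ^ (j + 1 + l) + ‖dF lam z‖⁻¹ ^ (j + l) := by
        rw [show j + 1 + l = (j + l) + 1 by ring, pow_succ, mul_add, mul_one, mul_assoc,
          inv_mul_cancel₀ hw.ne', mul_one]
      have hle : ∀ n ≤ 2 * j + 1, ‖dF lam z‖⁻¹ ^ n ≤ b⁻¹ ^ (2 * j + 1) := fun n hn =>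
        (pow_le_pow_left₀ (by positivity) (inv_anti₀ hb hbw) n).trans
          (pow_le_pow_right₀ hbi hn)
      rw [e, two_mul]
      exact add_le_add (hle _ (by omega)) (hle _ (by omega))
    have h2 := norm_inv_mul_ibpCoeff_le (hK l) hz2
    calc _ = (‖(z * (1 - z))⁻¹ ^ j‖ * ‖(ibpCoeff j l).eval z‖)
          * (‖dF lam z‖⁻¹ ^ (j + 1 + l) * (1 + ‖dF lam z‖)) := by
          rw [norm_mul, norm_pow (dF lam z)⁻¹, norm_inv (dF lam z)]; ring
      _ ≤ (K l * ‖1 - z‖⁻¹ ^ j) * (2 * b⁻¹ ^ (2 * j + 1)) := by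
          have := hK0 l
          gcongr
      _ = _ := by ring
  have hsum : ‖(z * (1 - z))⁻¹ ^ j‖ * ‖ibpSum lam j z‖ * (1 + ‖dF lam z‖)
      ≤ (∑ l ∈ Finset.range (j + 1), 2 * K l) * ‖1 - z‖⁻¹ ^ j * b⁻¹ ^ (2 * j + 1) := by
    refine le_trans ?_ ((Finset.sum_le_sum hterm).trans_eq ?_)
    · rw [← Finset.sum_mul, ← Finset.mul_sum]
      gcongr
      exact norm_sum_le _ _
    · rw [Finset.sum_mul, Finset.sum_mul]
  calc _ = ‖1 - z‖ ^ (-(1 / 2) : ℝ)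
        * (‖(z * (1 - z))⁻¹ ^ j‖ * ‖ibpSum lam j z‖ * (1 + ‖dF lam z‖)) := by
        rw [ibpClosed, norm_mul, norm_mul, norm_one_sub_cpow_neg_half]; ring
    _ ≤ _ := (mul_le_mul_of_nonneg_left hsum (by positivity)).trans_eq (by ring)

/-- The sharp form: only the leading coefficient carries a full power of `b⁻¹`. -/
theorem exists_norm_ibpClosed_le_leading (j : ℕ) : ∃ K : ℝ, 0 ≤ K ∧ ∀ (lam b : ℝ) (z : ℂ),
    z ∈ cutPlane → 1 / 2 ≤ ‖z‖ → 0 < b → b ≤ 1 → b ≤ ‖dF lam z‖ →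
    ‖ibpClosed lam j z‖ ≤ ‖1 - z‖ ^ (-(1 / 2) : ℝ) * ‖1 - z‖⁻¹ ^ j * b⁻¹ ^ (2 * j + 1)
      * (‖z‖⁻¹ ^ j * (Nat.doubleFactorial (2 * j - 1) : ℝ) + K * b) := by
  choose K hK0 hK using exists_norm_ibpCoeff_le j
  refine ⟨∑ l ∈ Finset.range j, K l, Finset.sum_nonneg fun l _ => hK0 l,
    fun lam b z hz hz2 hb hb1 hbw => ?_⟩
  have hw : 0 < ‖dF lam z‖ := hb.trans_le hbw
  have hbi : 1 ≤ b⁻¹ := (one_le_inv₀ hb).2 hb1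
  have hle : ∀ n, ‖dF lam z‖⁻¹ ^ n ≤ b⁻¹ ^ n := fun n =>
    pow_le_pow_left₀ (by positivity) (inv_anti₀ hb hbw) n
  have hterm : ∀ l ∈ Finset.range j,
      ‖(z * (1 - z))⁻¹ ^ j‖ * ‖(ibpCoeff j l).eval z * (dF lam z)⁻¹ ^ (j + 1 + l)‖
        ≤ K l * (‖1 - z‖⁻¹ ^ j * b⁻¹ ^ (2 * j)) := by
    intro l hl
    have hl' := Finset.mem_range.1 hl
    have h2 := norm_inv_mul_ibpCoeff_le (hK l) hz2
    calc _ = (‖(z * (1 - z))⁻¹ ^ j‖ * ‖(ibpCoeff j l).eval z‖)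
          * ‖dF lam z‖⁻¹ ^ (j + 1 + l) := by
          rw [norm_mul, norm_pow (dF lam z)⁻¹, norm_inv (dF lam z)]; ring
      _ ≤ (K l * ‖1 - z‖⁻¹ ^ j) * b⁻¹ ^ (2 * j) := by
          have := hK0 l
          have h3 := (hle (j + 1 + l)).trans (pow_le_pow_right₀ hbi (show j + 1 + l ≤ 2 * j by omega))
          gcongr
      _ = _ := by ring
  have hlead : ‖(z * (1 - z))⁻¹ ^ j‖ * ‖(ibpCoeff j j).eval z * (dF lam z)⁻¹ ^ (j + 1 + j)‖
      ≤ ‖1 - z‖⁻¹ ^ j * b⁻¹ ^ (2 * j + 1)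
        * (‖z‖⁻¹ ^ j * (Nat.doubleFactorial (2 * j - 1) : ℝ)) := by
    rw [ibpCoeff_self, Polynomial.eval_C, norm_mul, norm_mul, norm_pow (-1 : ℂ), norm_neg, norm_one,
      one_pow, one_mul, Complex.norm_natCast, norm_pow, norm_pow, norm_inv, norm_inv, norm_mul,
      mul_inv, mul_pow, show j + 1 + j = 2 * j + 1 by ring]
    calc _ = ‖1 - z‖⁻¹ ^ j * ‖dF lam z‖⁻¹ ^ (2 * j + 1)
        * (‖z‖⁻¹ ^ j * (Nat.doubleFactorial (2 * j - 1) : ℝ)) := by ring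
      _ ≤ _ := by gcongr
  have hsum : ‖(z * (1 - z))⁻¹ ^ j‖ * ‖ibpSum lam j z‖
      ≤ ‖1 - z‖⁻¹ ^ j * b⁻¹ ^ (2 * j + 1)
        * (‖z‖⁻¹ ^ j * (Nat.doubleFactorial (2 * j - 1) : ℝ)
          + (∑ l ∈ Finset.range j, K l) * b) := by
    have hb' : b⁻¹ ^ (2 * j + 1) * b = b⁻¹ ^ (2 * j) := by
      rw [pow_succ, mul_assoc, inv_mul_cancel₀ hb.ne', mul_one]
    have h3 := Finset.sum_le_sum hterm
    rw [← Finset.mul_sum, ← Finset.sum_mul] at h3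
    calc _ ≤ ‖(z * (1 - z))⁻¹ ^ j‖ * (∑ l ∈ Finset.range j,
            ‖(ibpCoeff j l).eval z * (dF lam z)⁻¹ ^ (j + 1 + l)‖
            + ‖(ibpCoeff j j).eval z * (dF lam z)⁻¹ ^ (j + 1 + j)‖) := by
          gcongr
          rw [ibpSum, Finset.sum_range_succ]
          exact (norm_add_le _ _).trans (by gcongr; exact norm_sum_le _ _)
      _ ≤ (∑ l ∈ Finset.range j, K l) * (‖1 - z‖⁻¹ ^ j * b⁻¹ ^ (2 * j))
          + ‖1 - z‖⁻¹ ^ j * b⁻¹ ^ (2 * j + 1)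
            * (‖z‖⁻¹ ^ j * (Nat.doubleFactorial (2 * j - 1) : ℝ)) := by
          rw [mul_add]; exact add_le_add h3 hlead
      _ = _ := by rw [← hb']; ring
  calc _ = ‖1 - z‖ ^ (-(1 / 2) : ℝ)
        * (‖(z * (1 - z))⁻¹ ^ j‖ * ‖ibpSum lam j z‖) := by
        rw [ibpClosed, norm_mul, norm_mul, norm_one_sub_cpow_neg_half]; ring
    _ ≤ _ := (mul_le_mul_of_nonneg_left hsum (by positivity)).trans_eq (by ring)

theorem norm_iterate_ibpOp {t lam : ℝ} (ht : 0 < t) (j : ℕ) {z : ℂ} (hz : z ∈ regularSet lam) :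
    ‖(ibpOp t lam)^[j] (ibpStart t lam) z‖ = t⁻¹ ^ (j + 1) * ‖ibpClosed lam j z‖ := by
  rw [iterate_ibpOp_eq ht.ne' j hz]
  simp [abs_of_pos ht]

/-! ### Estimates of the phase -/

theorem norm_exp_phase (t : ℝ) (w : ℂ) :
    ‖Complex.exp (Complex.I * t * w)‖ = Real.exp (-(t * w.im)) := by
  rw [Complex.norm_exp]; congr 1; simp

theorem mem_cutPlane_of_im_pos {z : ℂ} (hz : 0 < z.im) : z ∈ cutPlane := by
  refine ⟨Or.inr hz.ne', Or.inr ?_⟩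
  simpa using hz.ne'

theorem ofReal_mem_cutPlane {x : ℝ} (h0 : 0 < x) (h1 : x < 1) : (x : ℂ) ∈ cutPlane := by
  refine ⟨Or.inl (by simpa using h0), Or.inl (by simpa using h1)⟩

theorem log_neg_of_im_pos {z : ℂ} (hz : 0 < z.im) :
    Complex.log (-z) = Complex.log z - Real.pi * Complex.I := by
  rw [Complex.log, Complex.log, Complex.arg_neg_eq_arg_sub_pi_of_im_pos hz, norm_neg]
  push_cast
  ring

/-- The derivative of `w log w` is `log w + 1`, whose imaginary part `arg w` is nonnegative in the
upper half plane. -/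
theorem monotoneOn_im_mul_log {z : ℂ} (hz : 0 < z.im) :
    Monotone (fun s : ℝ => ((z + s) * Complex.log (z + s)).im) := by
  have him : ∀ s : ℝ, 0 < (z + s).im := fun s => by simpa using hz
  have hd : ∀ s : ℝ, HasDerivAt (fun s : ℝ => ((z + s) * Complex.log (z + s)).im)
      (Complex.arg (z + s)) s := fun s => by
    have h1 : HasDerivAt (fun s : ℝ => z + (s : ℂ)) 1 s :=
      (Complex.ofRealCLM.hasDerivAt (x := s)).const_add z
    have h2 := h1.mul (h1.clog_real (Or.inr (him s).ne'))
    have h3 := Complex.imCLM.hasFDerivAt.comp_hasDerivAt s h2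
    refine h3.congr_deriv ?_
    have : z + (s : ℂ) ≠ 0 := fun h => by have := him s; rw [h] at this; simp at this
    rw [mul_one_div_cancel this]
    simp [Complex.log_im]
  refine monotone_of_deriv_nonneg (fun s => (hd s).differentiableAt) fun s => ?_
  rw [(hd s).deriv]
  exact Complex.arg_nonneg_iff.2 (him s).le

/-- Rewriting `log (1-z)` as `log (z-1) - πi` leaves the difference of `w log w` at `z` and `z - 1`,
whose imaginary part is nonnegative by monotonicity. The resulting linear bound gives exponential
decay along every admissible ray. -/
theorem le_im_F {z : ℂ} (hz : 0 < z.im) (lam : ℝ) :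
    Real.pi * (z.re - 1) + z.im * Real.log lam ≤ (F z lam).im := by
  have hz' : 0 < (z - 1).im := by simpa using hz
  have h := monotoneOn_im_mul_log hz' (zero_le_one' ℝ)
  simp only [Complex.ofReal_zero, add_zero, Complex.ofReal_one, sub_add_cancel] at h
  have hl : Complex.log (1 - z) = Complex.log (z - 1) - Real.pi * Complex.I := by
    rw [← log_neg_of_im_pos hz', neg_sub]
  have hF : F z lam = z * Complex.log z - (z - 1) * Complex.log (z - 1)
      + Real.pi * (z - 1) * Complex.I + z * (Real.log lam : ℂ) := by
    rw [F, hl]; ring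
  rw [hF]
  have e1 : ((Real.pi : ℂ) * (z - 1) * Complex.I).im = Real.pi * (z.re - 1) := by simp
  have e2 : (z * (Real.log lam : ℂ)).im = z.im * Real.log lam := by simp
  rw [Complex.add_im, Complex.add_im, Complex.sub_im, e1, e2]
  linarith

theorem norm_exp_phase_le {z : ℂ} (hz : 0 < z.im) {t : ℝ} (ht : 0 ≤ t) (lam : ℝ) :
    ‖Complex.exp (Complex.I * t * F z lam)‖
      ≤ Real.exp (-(t * (Real.pi * (z.re - 1) + z.im * Real.log lam))) := by
  rw [norm_exp_phase]
  gcongr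
  exact le_im_F hz lam

theorem F_ofReal {x : ℝ} (h0 : 0 ≤ x) (h1 : x ≤ 1) (lam : ℝ) :
    F x lam = ((1 - x) * Real.log (1 - x) + x * Real.log x + x * Real.log lam : ℝ) := by
  rw [F, ← Complex.ofReal_log h0, show (1 : ℂ) - x = ((1 - x : ℝ) : ℂ) by push_cast; rfl,
    ← Complex.ofReal_log (by linarith)]
  push_cast
  ring

theorem dF_ofReal {x : ℝ} (h0 : 0 < x) (h1 : x < 1) (lam : ℝ) :
    dF lam x = (Real.log x - Real.log (1 - x) + Real.log lam : ℝ) := by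
  rw [dF_eq (ofReal_mem_cutPlane h0 h1), ← Complex.ofReal_log h0.le,
    show (1 : ℂ) - x = ((1 - x : ℝ) : ℂ) by push_cast; rfl, ← Complex.ofReal_log (by linarith)]
  push_cast
  ring

/-! ### The phase along a slanted ray -/

/-- The point at parameter `R` on the ray from `1 - k` in the direction `1 + iη`. -/
noncomputable def slantRay (k η R : ℝ) : ℂ := (1 - k : ℝ) + R * (1 + η * Complex.I)

theorem slantRay_re (k η R : ℝ) : (slantRay k η R).re = 1 - k + R := by simp [slantRay]

theorem slantRay_im (k η R : ℝ) : (slantRay k η R).im = R * η := by simp [slantRay]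

theorem slantRay_zero (k η : ℝ) : slantRay k η 0 = (1 - k : ℝ) := by simp [slantRay]

theorem hasDerivAt_slantRay (k η R : ℝ) :
    HasDerivAt (slantRay k η) (1 + η * Complex.I) R := by
  refine (((Complex.ofRealCLM.hasDerivAt (x := R)).mul_const
    (1 + η * Complex.I)).const_add ((1 - k : ℝ) : ℂ)).congr_deriv ?_
  simp

section Slant

variable {k η lam : ℝ}

theorem slantRay_mem_cutPlane (hk0 : 0 < k) (hk1 : k ≤ 1 / 2) (hη : 0 < η) {R : ℝ} (hR : 0 ≤ R) :
    slantRay k η R ∈ cutPlane := by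
  rcases hR.eq_or_lt with rfl | hR
  · rw [slantRay_zero]
    exact ofReal_mem_cutPlane (by linarith) (by linarith)
  · exact mem_cutPlane_of_im_pos (by rw [slantRay_im]; positivity)

theorem dF_re {z : ℂ} (hz : z ∈ cutPlane) (lam : ℝ) :
    (dF lam z).re = Real.log ‖z‖ - Real.log ‖1 - z‖ + Real.log lam := by
  rw [dF_eq hz]; simp [Complex.log_re]

theorem dF_im {z : ℂ} (hz : z ∈ cutPlane) (lam : ℝ) :
    (dF lam z).im = Complex.arg z - Complex.arg (1 - z) := by
  rw [dF_eq hz]; simp [Complex.log_im]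

theorem half_le_norm_slantRay (hk1 : k ≤ 1 / 2) {R : ℝ} (hR : 0 ≤ R) :
    1 / 2 ≤ ‖slantRay k η R‖ := by
  have := (Complex.re_le_norm (slantRay k η R))
  rw [slantRay_re] at this
  linarith

/-- The real part `k - R` of `1 - z` is large up to `R = k/2`, and the modulus `ηR` of its imaginary
part takes over from there. -/
theorem le_norm_one_sub_slantRay (hk0 : 0 < k) (hη : 0 < η) (hη1 : η ≤ 1) (R : ℝ) :
    η * k / 2 ≤ ‖1 - slantRay k η R‖ := by
  rcases le_total R (k / 2) with h | h
  · have := (Complex.re_le_norm (1 - slantRay k η R))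
    rw [Complex.sub_re, slantRay_re, Complex.one_re] at this
    nlinarith
  · have := (Complex.abs_im_le_norm (1 - slantRay k η R))
    rw [Complex.sub_im, slantRay_im, Complex.one_im, zero_sub, abs_neg] at this
    nlinarith [le_abs_self (R * η)]

theorem im_dF_slantRay_nonneg (hk0 : 0 < k) (hk1 : k ≤ 1 / 2) (hη : 0 < η) {R : ℝ} (hR : 0 ≤ R) :
    0 ≤ (dF lam (slantRay k η R)).im := by
  rw [dF_im (slantRay_mem_cutPlane hk0 hk1 hη hR)]
  have h1 : 0 ≤ Complex.arg (slantRay k η R) :=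
    Complex.arg_nonneg_iff.2 (by rw [slantRay_im]; positivity)
  have h2 : Complex.arg (1 - slantRay k η R) ≤ 0 := by
    rcases hR.eq_or_lt with rfl | hR
    · rw [slantRay_zero, show (1 : ℂ) - (1 - k : ℝ) = (k : ℂ) by push_cast; ring,
        Complex.arg_ofReal_of_nonneg hk0.le]
    · refine (Complex.arg_neg_iff.2 ?_).le
      rw [Complex.sub_im, slantRay_im, Complex.one_im, zero_sub]
      exact neg_neg_of_pos (by positivity)
  linarith

/-- Beyond `R = k` the point `1 - z` lies in the closed left half plane below the real axis, so its
argument is at most `-π/2`. -/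
theorem pi_div_two_le_im_dF_slantRay (hk0 : 0 < k) (hk1 : k ≤ 1 / 2) (hη : 0 < η) {R : ℝ}
    (hR : k ≤ R) : Real.pi / 2 ≤ (dF lam (slantRay k η R)).im := by
  have hR0 : 0 < R := hk0.trans_le hR
  rw [dF_im (slantRay_mem_cutPlane hk0 hk1 hη hR0.le)]
  have h1 : 0 ≤ Complex.arg (slantRay k η R) :=
    Complex.arg_nonneg_iff.2 (by rw [slantRay_im]; positivity)
  have him : (1 - slantRay k η R).im < 0 := by
    rw [Complex.sub_im, slantRay_im, Complex.one_im, zero_sub]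
    exact neg_neg_of_pos (by positivity)
  have h2 : Complex.arg (1 - slantRay k η R) < 0 := Complex.arg_neg_iff.2 him
  have h3 : ¬ |Complex.arg (1 - slantRay k η R)| < Real.pi / 2 := by
    rw [Complex.abs_arg_lt_pi_div_two_iff]
    rintro (h | h)
    · rw [Complex.sub_re, slantRay_re, Complex.one_re] at h
      linarith
    · rw [h] at him; simp at him
  rw [abs_of_neg h2] at h3
  linarith

theorem le_re_dF_slantRay (hk0 : 0 < k) (hk1 : k ≤ 1 / 2) (hη : 0 < η) (hη1 : η ≤ 1) {R : ℝ}
    (hR0 : 0 ≤ R) (hR : R ≤ k) :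
    Real.log (1 - k) - Real.log k + Real.log lam ≤ (dF lam (slantRay k η R)).re := by
  have hmem := slantRay_mem_cutPlane hk0 hk1 hη hR0
  rw [dF_re hmem]
  have h1 : 1 - k ≤ ‖slantRay k η R‖ := by
    have := (Complex.re_le_norm (slantRay k η R))
    rw [slantRay_re] at this
    linarith
  have h2 : ‖1 - slantRay k η R‖ ≤ k := by
    refine abs_le_of_sq_le_sq' ?_ hk0.le |>.2
    rw [Complex.sq_norm, Complex.normSq_apply, Complex.sub_re, Complex.sub_im, slantRay_re,
      slantRay_im, Complex.one_re, Complex.one_im]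
    nlinarith [mul_nonneg hR0 (sub_nonneg.2 hR), mul_nonneg hη.le (sub_nonneg.2 hη1),
      mul_nonneg (mul_nonneg hR0 hR0) (show 0 ≤ 1 - η ^ 2 by nlinarith)]
  have h3 := Real.log_le_log (by linarith) h1
  have h4 := Real.log_le_log (norm_pos_iff.2 (one_sub_ne_zero_of_mem_cutPlane hmem)) h2
  linarith

theorem log_le_re_dF_slantRay (hk0 : 0 < k) (hk1 : k ≤ 1 / 2) (hη : 0 < η) {R : ℝ} (hR0 : 0 ≤ R) :
    Real.log lam ≤ (dF lam (slantRay k η R)).re := by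
  have hmem := slantRay_mem_cutPlane hk0 hk1 hη hR0
  rw [dF_re hmem]
  have h2 : ‖1 - slantRay k η R‖ ≤ ‖slantRay k η R‖ := by
    refine abs_le_of_sq_le_sq' ?_ (norm_nonneg _) |>.2
    rw [Complex.sq_norm, Complex.normSq_apply, Complex.sub_re, Complex.sub_im, Complex.sq_norm,
      Complex.normSq_apply, slantRay_re, slantRay_im, Complex.one_re, Complex.one_im]
    nlinarith
  have h4 := Real.log_le_log (norm_pos_iff.2 (one_sub_ne_zero_of_mem_cutPlane hmem)) h2
  linarith

/-- The real part of `F'` gives the bound up to `R = k`, the imaginary part after it. No stationary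
point is met on the ray. -/
theorem le_norm_dF_slantRay (hk0 : 0 < k) (hk1 : k ≤ 1 / 2) (hη : 0 < η) (hη1 : η ≤ 1) {b : ℝ}
    (hb1 : b ≤ 1) (hb : b ≤ Real.log (1 - k) - Real.log k + Real.log lam) {R : ℝ} (hR : 0 ≤ R) :
    b ≤ ‖dF lam (slantRay k η R)‖ := by
  rcases le_total R k with h | h
  · exact hb.trans ((le_re_dF_slantRay hk0 hk1 hη hη1 hR h).trans (Complex.re_le_norm _))
  · have h1 := pi_div_two_le_im_dF_slantRay (lam := lam) hk0 hk1 hη h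
    have h2 := (le_abs_self _).trans (Complex.abs_im_le_norm (dF lam (slantRay k η R)))
    linarith [Real.pi_gt_three]

theorem hasDerivAt_im_F_slantRay (hk0 : 0 < k) (hk1 : k ≤ 1 / 2) (hη : 0 < η) {R : ℝ}
    (hR : 0 ≤ R) : HasDerivAt (fun R => (F (slantRay k η R) lam).im)
      ((dF lam (slantRay k η R)).im + η * (dF lam (slantRay k η R)).re) R := by
  have h := (hasDerivAt_F (slantRay_mem_cutPlane hk0 hk1 hη hR) lam).comp R
    (hasDerivAt_slantRay k η R)
  refine (Complex.imCLM.hasFDerivAt.comp_hasDerivAt R h).congr_deriv ?_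
  simp
  ring

theorem im_F_slantRay_nonneg (hk0 : 0 < k) (hk1 : k ≤ 1 / 2) (hη : 0 < η) (hη1 : η ≤ 1)
    (hb : 0 ≤ Real.log (1 - k) - Real.log k + Real.log lam) {R : ℝ} (hR0 : 0 ≤ R) (hR : R ≤ k) :
    0 ≤ (F (slantRay k η R) lam).im := by
  have hm : MonotoneOn (fun R => (F (slantRay k η R) lam).im) (Set.Icc 0 k) := by
    refine monotoneOn_of_deriv_nonneg (convex_Icc 0 k)
      (fun x hx => (hasDerivAt_im_F_slantRay hk0 hk1 hη hx.1).continuousAt.continuousWithinAt)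
      (fun x hx => ?_) fun x hx => ?_
    all_goals rw [interior_Icc] at hx
    · exact (hasDerivAt_im_F_slantRay hk0 hk1 hη hx.1.le).differentiableAt.differentiableWithinAt
    · rw [(hasDerivAt_im_F_slantRay hk0 hk1 hη hx.1.le).deriv]
      have h1 := im_dF_slantRay_nonneg (lam := lam) hk0 hk1 hη hx.1.le
      have h2 := le_re_dF_slantRay (lam := lam) hk0 hk1 hη hη1 hx.1.le hx.2.le
      have := mul_nonneg hη.le (hb.trans h2)
      linarith
  have := hm ⟨le_rfl, hk0.le⟩ ⟨hR0, hR⟩ hR0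
  simp only [slantRay_zero] at this
  rwa [F_ofReal (by linarith) (by linarith), Complex.ofReal_im] at this

/-- For `R ≥ k` the derivative of `Im F` along the ray is at least `π/2 + η ln λ ≥ π/2 - 1 ≥ 1/2`.
-/
theorem le_im_F_slantRay (hk0 : 0 < k) (hk1 : k ≤ 1 / 2) (hη : 0 < η) (hη1 : η ≤ 1)
    (hlam : -1 ≤ η * Real.log lam)
    (hb : 0 ≤ Real.log (1 - k) - Real.log k + Real.log lam) {R : ℝ} (hR : k ≤ R) :
    (R - k) / 2 ≤ (F (slantRay k η R) lam).im := by
  have hd : ∀ x, k ≤ x → HasDerivAt (fun R => (F (slantRay k η R) lam).im - R / 2)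
      ((dF lam (slantRay k η x)).im + η * (dF lam (slantRay k η x)).re - 1 / 2) x := fun x hx =>
    (hasDerivAt_im_F_slantRay hk0 hk1 hη (hk0.le.trans hx)).sub ((hasDerivAt_id x).div_const 2)
  have hm : MonotoneOn (fun R => (F (slantRay k η R) lam).im - R / 2) (Set.Ici k) := by
    refine monotoneOn_of_deriv_nonneg (convex_Ici k)
      (fun x hx => (hd x hx).continuousAt.continuousWithinAt)
      (fun x hx => ?_) fun x hx => ?_
    all_goals rw [interior_Ici] at hx
    · exact (hd x (le_of_lt hx)).differentiableAt.differentiableWithinAt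
    · rw [(hd x (le_of_lt hx)).deriv]
      have h1 := pi_div_two_le_im_dF_slantRay (lam := lam) hk0 hk1 hη (le_of_lt hx)
      have h2 := log_le_re_dF_slantRay (lam := lam) hk0 hk1 hη (hk0.le.trans (le_of_lt hx))
      have := mul_le_mul_of_nonneg_left h2 hη.le
      linarith [Real.pi_gt_three]
  have h1 := hm (Set.mem_Ici.2 le_rfl) hR hR
  have h2 := im_F_slantRay_nonneg hk0 hk1 hη hη1 hb hk0.le le_rfl
  simp only at h1
  linarith

/-- The decay is really exponential past `k`. The weaker form `(1+R)^(-2)` is uniform in `t` and has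
an elementary primitive. -/
theorem norm_exp_phase_slantRay_le (hk0 : 0 < k) (hk1 : k ≤ 1 / 2) (hη : 0 < η) (hη1 : η ≤ 1)
    (hlam : -1 ≤ η * Real.log lam)
    (hb : 0 ≤ Real.log (1 - k) - Real.log k + Real.log lam) {t : ℝ} (ht : 2 ≤ t) {R : ℝ}
    (hR : 0 ≤ R) :
    ‖Complex.exp (Complex.I * t * F (slantRay k η R) lam)‖ ≤ 4 / (1 + R) ^ 2 := by
  rw [norm_exp_phase, le_div_iff₀ (by positivity)]
  rcases le_total R k with h | h
  · have h1 : Real.exp (-(t * (F (slantRay k η R) lam).im)) ≤ 1 :=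
      Real.exp_le_one_iff.2 (neg_nonpos.2 (mul_nonneg (by linarith)
        (im_F_slantRay_nonneg hk0 hk1 hη hη1 hb hR h)))
    nlinarith [Real.exp_pos (-(t * (F (slantRay k η R) lam).im))]
  · have h1 := le_im_F_slantRay hk0 hk1 hη hη1 hlam hb h
    have h2 : Real.exp (-(t * (F (slantRay k η R) lam).im)) ≤ Real.exp (-(R - k)) := by
      gcongr
      nlinarith
    have h3 : (1 + R) ^ 2 ≤ 4 * Real.exp (R - k) := by
      have h4 := Real.add_one_le_exp ((R - k) / 2)
      have h5 : Real.exp (R - k) = Real.exp ((R - k) / 2) ^ 2 := by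
        rw [← Real.exp_nat_mul]; congr 1; push_cast; ring
      rw [h5]
      nlinarith
    calc _ ≤ Real.exp (-(R - k)) * (4 * Real.exp (R - k)) := by gcongr
      _ = 4 := by rw [mul_left_comm, ← Real.exp_add, neg_add_cancel, Real.exp_zero, mul_one]

end Slant

/-! ### Change of contour -/

/-- A holomorphic function on a convex open set has a primitive. -/
theorem _root_.Convex.exists_primitive {s : Set ℂ} (hs : Convex ℝ s) (ho : IsOpen s) {f : ℂ → ℂ}
    (hf : DifferentiableOn ℂ f s) : ∃ g : ℂ → ℂ, ∀ z ∈ s, HasDerivAt g (f z) z := by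
  -- The form `f(z) dz` is closed because its derivative `(x, y) ↦ f'(z) x y` is symmetric.
  obtain ⟨g, hg⟩ := hs.exists_forall_hasFDerivWithinAt_of_hasFDerivWithinAt_symmetric
    (𝕜 := ℂ) (ω := fun z => ContinuousLinearMap.toSpanSingleton ℂ (f z))
    (dω := fun z => ((ContinuousLinearMap.toSpanSingletonCLE (𝕜 := ℂ) (E := ℂ)).toContinuousLinearMap.comp
      (ContinuousLinearMap.toSpanSingleton ℂ (deriv f z))).restrictScalars ℝ)
    (fun z hz => by
      have h := ((hf z hz).differentiableAt (ho.mem_nhds hz)).hasDerivAt.hasFDerivAt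
      exact ((ContinuousLinearMap.toSpanSingletonCLE (𝕜 := ℂ)
        (E := ℂ)).toContinuousLinearMap.hasFDerivAt.comp z h).restrictScalars
          ℝ |>.hasFDerivWithinAt)
    (fun a _ x _ y _ => by simp; ring)
  exact ⟨g, fun z hz => ((hg z hz).hasFDerivAt (ho.mem_nhds hz)).hasDerivAt.congr_deriv (by simp)⟩

/-- The integrand in the case `σ = 1/2`. -/
noncomputable def halfIntegrand (t lam : ℝ) (z : ℂ) : ℂ :=
  (1 - z) ^ (-(1 / 2) : ℂ) * Complex.exp (Complex.I * t * F z lam)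

theorem integrand_half (t lam : ℝ) (z : ℂ) :
    integrand (1 / 2) t lam z = halfIntegrand t lam z := by
  simp [integrand, halfIntegrand]

theorem differentiableAt_halfIntegrand (t lam : ℝ) {z : ℂ} (hz : z ∈ cutPlane) :
    DifferentiableAt ℂ (halfIntegrand t lam) z :=
  ((hasDerivAt_one_sub_cpow hz).mul (hasDerivAt_exp_phase hz t lam)).differentiableAt

theorem norm_halfIntegrand_le {t : ℝ} (ht : 0 ≤ t) (lam : ℝ) {z : ℂ} (hz : 0 < z.im) :
    ‖halfIntegrand t lam z‖ ≤ z.im ^ (-(1 / 2) : ℝ)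
      * Real.exp (-(t * (Real.pi * (z.re - 1) + z.im * Real.log lam))) := by
  rw [halfIntegrand, norm_mul, norm_one_sub_cpow_neg_half]
  refine mul_le_mul ?_ (norm_exp_phase_le hz ht lam) (norm_nonneg _) (by positivity)
  refine Real.rpow_le_rpow_of_nonpos hz ?_ (by norm_num)
  have := Complex.abs_im_le_norm (1 - z)
  rw [Complex.sub_im, Complex.one_im, zero_sub, abs_neg] at this
  exact (le_abs_self _).trans this

/-- A convex part of the cut plane, bounded by a line of slope `s` through `1`. -/
def wedge (s : ℝ) : Set ℂ := {z | 0 < z.re ∧ s * (z.re - 1) < z.im}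

theorem isOpen_wedge (s : ℝ) : IsOpen (wedge s) :=
  (isOpen_lt continuous_const Complex.continuous_re).inter
    (isOpen_lt (by fun_prop) Complex.continuous_im)

theorem convex_wedge (s : ℝ) : Convex ℝ (wedge s) := by
  intro x hx y hy a b ha hb hab
  have hx1 := hx.1; have hx2 := hx.2; have hy1 := hy.1; have hy2 := hy.2
  rcases ha.eq_or_lt with rfl | ha
  · simp only [zero_add] at hab
    simpa [hab] using hy
  · refine ⟨?_, ?_⟩
    · simp only [Complex.add_re, Complex.real_smul, Complex.re_ofReal_mul]
      nlinarith [mul_pos ha hx1, mul_nonneg hb hy1.le]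
    · simp only [Complex.add_re, Complex.real_smul, Complex.re_ofReal_mul, Complex.add_im,
        Complex.im_ofReal_mul]
      have e : s * (a * x.re + b * y.re - 1) = a * (s * (x.re - 1)) + b * (s * (y.re - 1)) := by
        linear_combination s * hab
      rw [e]
      have h1 := mul_lt_mul_of_pos_left hx2 ha
      have h2 := mul_le_mul_of_nonneg_left hy2.le hb
      linarith

theorem wedge_subset_cutPlane {s : ℝ} (hs : 0 < s) : wedge s ⊆ cutPlane := by
  intro z hz
  refine ⟨Or.inl hz.1, ?_⟩
  by_cases h : z.im = 0
  · left
    have := hz.2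
    rw [h] at this
    simp only [Complex.sub_re, Complex.one_re]
    nlinarith
  · right; simpa using h

theorem ofReal_mem_wedge {s x : ℝ} (hs : 0 < s) (h0 : 0 < x) (h1 : x < 1) :
    (x : ℂ) ∈ wedge s := by
  refine ⟨by simpa using h0, ?_⟩
  simp only [Complex.ofReal_re, Complex.ofReal_im]
  nlinarith

/-- The point at parameter `R` on the ray from `x` in the direction `c + i d`. -/
noncomputable def rayPoint (x c d R : ℝ) : ℂ := x + R * (c + d * Complex.I)

theorem rayPoint_re (x c d R : ℝ) : (rayPoint x c d R).re = x + R * c := by simp [rayPoint]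

theorem rayPoint_im (x c d R : ℝ) : (rayPoint x c d R).im = R * d := by simp [rayPoint]

theorem hasDerivAt_rayPoint (x c d R : ℝ) :
    HasDerivAt (rayPoint x c d) (c + d * Complex.I) R := by
  refine (((Complex.ofRealCLM.hasDerivAt (x := R)).mul_const
    (c + d * Complex.I)).const_add (x : ℂ)).congr_deriv ?_
  simp

theorem slantRay_eq_rayPoint (k η R : ℝ) : slantRay k η R = rayPoint (1 - k) 1 η R := by
  simp [slantRay, rayPoint]

theorem rayPoint_mem_wedge {s x c d R : ℝ} (hs : 0 < s) (h0 : 0 < x) (h1 : x < 1) (hc : 0 < c)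
    (hsd : s * c < d) (hR : 0 ≤ R) : rayPoint x c d R ∈ wedge s := by
  refine ⟨?_, ?_⟩
  · rw [rayPoint_re]; positivity
  · rw [rayPoint_re, rayPoint_im]
    nlinarith [mul_nonneg hR (sub_nonneg.2 hsd.le)]

theorem continuousOn_halfIntegrand_ray {x c d : ℝ} (h0 : 0 < x) (h1 : x < 1) (hc : 0 < c)
    (hd : 0 < d) (t lam : ℝ) :
    ContinuousOn (fun R => halfIntegrand t lam (rayPoint x c d R)) (Set.Ici 0) := by
  intro R hR
  have hs : 0 < d / c / 2 := by positivity
  have hmem : rayPoint x c d R ∈ cutPlane := wedge_subset_cutPlane hs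
    (rayPoint_mem_wedge hs h0 h1 hc (by field_simp; linarith) hR)
  exact ((differentiableAt_halfIntegrand t lam hmem).continuousAt.comp
    (hasDerivAt_rayPoint x c d R).continuousAt).continuousWithinAt

theorem norm_halfIntegrand_ray_le {t lam x c d R : ℝ} (ht : 0 ≤ t) (hR : 1 ≤ R) (hd : 0 < d) :
    ‖halfIntegrand t lam (rayPoint x c d R)‖ ≤ d ^ (-(1 / 2) : ℝ) * Real.exp (t * Real.pi * (1 - x))
      * Real.exp (-(t * (Real.pi * c + d * Real.log lam)) * R) := by
  have him : 0 < (rayPoint x c d R).im := by rw [rayPoint_im]; positivity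
  refine (norm_halfIntegrand_le ht lam him).trans ?_
  rw [rayPoint_im, rayPoint_re, mul_assoc (d ^ (-(1 / 2) : ℝ)), ← Real.exp_add]
  refine mul_le_mul ?_ (le_of_eq ?_) (Real.exp_pos _).le (by positivity)
  · exact Real.rpow_le_rpow_of_nonpos hd (by nlinarith) (by norm_num)
  · congr 1; ring

theorem integrableOn_halfIntegrand_ray {t lam x c d : ℝ} (ht : 0 < t) (h0 : 0 < x) (h1 : x < 1)
    (hc : 0 < c) (hd : 0 < d) (hcd : 0 < Real.pi * c + d * Real.log lam) :
    IntegrableOn (fun R => halfIntegrand t lam (rayPoint x c d R)) (Set.Ioi 0) := by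
  have hcont := continuousOn_halfIntegrand_ray h0 h1 hc hd t lam
  rw [IntegrableOn, ← integrable_norm_iff
    ((hcont.mono Set.Ioi_subset_Ici_self).aestronglyMeasurable measurableSet_Ioi)]
  refine integrable_of_isBigO_exp_neg (b := t * (Real.pi * c + d * Real.log lam)) (by positivity)
    hcont.norm ?_
  refine IsBigO.of_bound (d ^ (-(1 / 2) : ℝ) * Real.exp (t * Real.pi * (1 - x))) ?_
  filter_upwards [eventually_ge_atTop 1] with R hR
  rw [norm_norm, Real.norm_of_nonneg (Real.exp_pos _).le]
  exact norm_halfIntegrand_ray_le ht.le hR hd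

theorem tendsto_primitive_ray {t lam x c d : ℝ} (ht : 0 < t) (h0 : 0 < x) (h1 : x < 1)
    (hc : 0 < c) (hd : 0 < d) (hcd : 0 < Real.pi * c + d * Real.log lam) {g : ℂ → ℂ}
    (hg : ∀ R, 0 ≤ R →
      HasDerivAt g (halfIntegrand t lam (rayPoint x c d R)) (rayPoint x c d R)) :
    Tendsto (fun R => g (rayPoint x c d R)) atTop (nhds (g x
      + ∫ R in Set.Ioi (0 : ℝ), halfIntegrand t lam (rayPoint x c d R) * (c + d * Complex.I))) := by
  have hi : IntegrableOn (fun R => halfIntegrand t lam (rayPoint x c d R) * (c + d * Complex.I))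
      (Set.Ioi 0) := (integrableOn_halfIntegrand_ray ht h0 h1 hc hd hcd).mul_const _
  have hlim := intervalIntegral_tendsto_integral_Ioi 0 hi tendsto_id
  refine (hlim.const_add (g x)).congr' ?_
  filter_upwards [eventually_ge_atTop 0] with R hR
  rw [id, intervalIntegral.integral_eq_sub_of_hasDerivAt (f := fun R => g (rayPoint x c d R))]
  · simp [rayPoint]
  · intro y hy
    rw [Set.uIcc_of_le hR] at hy
    exact (hg y hy.1).comp y (hasDerivAt_rayPoint x c d y)
  · rw [intervalIntegrable_iff_integrableOn_Ioc_of_le hR]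
    exact hi.mono_set Set.Ioc_subset_Ioi_self

/-- A primitive has the same limit along any two rays in the region of decay. -/
theorem tendsto_primitive_sub {t lam x c d y c' d' : ℝ} (ht : 0 < t)
    (hx0 : 0 < x) (hx1 : x < 1) (hy0 : 0 < y) (hy1 : y < 1)
    (hc : 0 < c) (hd : 0 < d) (hcd : 0 < Real.pi * c + d * Real.log lam)
    (hc' : 0 < c') (hd' : 0 < d') (hcd' : 0 < Real.pi * c' + d' * Real.log lam)
    {s : ℝ} {g : ℂ → ℂ} (hg : ∀ z ∈ wedge s, HasDerivAt g (halfIntegrand t lam z) z)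
    (hs : 0 < s) (hsd : s * c < d) (hsd' : s * c' < d') :
    Tendsto (fun R => g (rayPoint y c' d' R) - g (rayPoint x c d R)) atTop (nhds 0) := by
  -- The points at parameter `R` on the two rays are joined by a segment of length `O(R)`. Height
  -- and decay exponent are affine in the point, so on the segment they stay above `q R` and `e R -
  -- π`.
  set e := min (Real.pi * c + d * Real.log lam) (Real.pi * c' + d' * Real.log lam) with he
  have he0 : 0 < e := lt_min hcd hcd'
  set q := min d d' with hq
  have hq0 : 0 < q := lt_min hd hd'
  set V := ‖((c' - c : ℝ) : ℂ) + ((d' - d : ℝ) : ℂ) * Complex.I‖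
  have hbound : ∀ᶠ R : ℝ in atTop, ‖g (rayPoint y c' d' R) - g (rayPoint x c d R)‖
      ≤ q ^ (-(1 / 2) : ℝ) * Real.exp (t * Real.pi) * (1 + V)
        * (R ^ (1 : ℝ) * Real.exp (-(t * e) * R)) := by
    filter_upwards [eventually_ge_atTop 1] with R hR
    have hR0 : 0 ≤ R := by linarith
    have hA := rayPoint_mem_wedge hs hx0 hx1 hc hsd hR0
    have hB := rayPoint_mem_wedge hs hy0 hy1 hc' hsd' hR0
    have hseg := (convex_wedge s).segment_subset hA hB
    have hfb : ∀ z ∈ segment ℝ (rayPoint x c d R) (rayPoint y c' d' R),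
        ‖halfIntegrand t lam z‖ ≤ q ^ (-(1 / 2) : ℝ)
          * (Real.exp (t * Real.pi) * Real.exp (-(t * e) * R)) := by
      rintro z ⟨α, β, hα, hβ, hαβ, rfl⟩
      have him : (α • rayPoint x c d R + β • rayPoint y c' d' R).im
          = R * (α * d + β * d') := by
        simp only [Complex.add_im, Complex.real_smul, Complex.im_ofReal_mul, rayPoint_im]; ring
      have hre : (α • rayPoint x c d R + β • rayPoint y c' d' R).re
          = α * (x + R * c) + β * (y + R * c') := by
        simp only [Complex.add_re, Complex.real_smul, Complex.re_ofReal_mul, rayPoint_re]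
      have h1 : q ≤ α * d + β * d' := by
        have := mul_le_mul_of_nonneg_left (min_le_left d d') hα
        have := mul_le_mul_of_nonneg_left (min_le_right d d') hβ
        nlinarith
      have h2 : e ≤ α * (Real.pi * c + d * Real.log lam)
          + β * (Real.pi * c' + d' * Real.log lam) := by
        have := mul_le_mul_of_nonneg_left
          (min_le_left (Real.pi * c + d * Real.log lam) (Real.pi * c' + d' * Real.log lam)) hα
        have := mul_le_mul_of_nonneg_left
          (min_le_right (Real.pi * c + d * Real.log lam) (Real.pi * c' + d' * Real.log lam)) hβ
        nlinarith
      have him0 : 0 < (α • rayPoint x c d R + β • rayPoint y c' d' R).im := by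
        rw [him]; exact mul_pos (by linarith) (hq0.trans_le h1)
      refine (norm_halfIntegrand_le ht.le lam him0).trans ?_
      rw [← Real.exp_add]
      refine mul_le_mul ?_ ?_ (Real.exp_pos _).le (by positivity)
      · refine Real.rpow_le_rpow_of_nonpos hq0 ?_ (by norm_num)
        rw [him]
        nlinarith
      · rw [Real.exp_le_exp, him, hre]
        have h3 : R * e ≤ R * (α * (Real.pi * c + d * Real.log lam)
          + β * (Real.pi * c' + d' * Real.log lam)) := mul_le_mul_of_nonneg_left h2 hR0
        have h4 : 0 ≤ α * x + β * y := by positivity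
        have h5 : 0 ≤ Real.pi * (α * x + β * y) := mul_nonneg Real.pi_pos.le h4
        have h6 : R * e - Real.pi ≤ Real.pi * (α * (x + R * c) + β * (y + R * c') - 1)
            + R * (α * d + β * d') * Real.log lam := by
          linarith
        nlinarith [mul_le_mul_of_nonneg_left h6 ht.le]
    have hmv := (convex_segment (𝕜 := ℝ) (rayPoint x c d R)
      (rayPoint y c' d' R)).norm_image_sub_le_of_norm_hasDerivWithin_le
      (fun z hz => (hg z (hseg hz)).hasDerivWithinAt) hfb (left_mem_segment ℝ _ _)
      (right_mem_segment ℝ _ _)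
    have hV : ‖rayPoint y c' d' R - rayPoint x c d R‖ ≤ (1 + V) * R := by
      have e1 : rayPoint y c' d' R - rayPoint x c d R
          = ((y - x : ℝ) : ℂ) + R * (((c' - c : ℝ) : ℂ) + ((d' - d : ℝ) : ℂ) * Complex.I) := by
        simp only [rayPoint]; push_cast; ring
      rw [e1]
      refine (norm_add_le _ _).trans ?_
      rw [norm_mul, Complex.norm_real, Complex.norm_real, Real.norm_of_nonneg hR0]
      have : ‖y - x‖ ≤ 1 := abs_le.2 ⟨by linarith, by linarith⟩
      nlinarith
    refine hmv.trans ?_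
    calc _ ≤ q ^ (-(1 / 2) : ℝ) * (Real.exp (t * Real.pi) * Real.exp (-(t * e) * R))
          * ((1 + V) * R) := by gcongr
      _ = _ := by rw [Real.rpow_one]; ring
  refine squeeze_zero_norm' hbound ?_
  have := (tendsto_rpow_mul_exp_neg_mul_atTop_nhds_zero 1 (t * e) (by positivity)).const_mul
    (q ^ (-(1 / 2) : ℝ) * Real.exp (t * Real.pi) * (1 + V))
  simpa using this

/-- The last quantity is, up to the factor `t`, the decay rate along the ray. Its positivity is what
the condition `tan φ < π/|ln λ|` encodes when `ln λ < 0`. -/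
theorem AdmissibleAngle.trig {lam φ : ℝ} (h : AdmissibleAngle lam φ) :
    0 < Real.cos φ ∧ 0 < Real.sin φ ∧ 0 < Real.pi * Real.cos φ + Real.sin φ * Real.log lam := by
  obtain ⟨h0, h1, h2⟩ := h
  have hlt : φ < Real.pi / 2 := by
    rcases le_or_gt 0 (Real.log lam) with h | h
    · exact h1 h
    · exact (h2 h).trans (Real.arctan_lt_pi_div_two _)
  have hc : 0 < Real.cos φ := Real.cos_pos_of_mem_Ioo ⟨by linarith, hlt⟩
  have hs : 0 < Real.sin φ := Real.sin_pos_of_pos_of_lt_pi h0 (by linarith [Real.pi_pos])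
  refine ⟨hc, hs, ?_⟩
  rcases le_or_gt 0 (Real.log lam) with h | h
  · have := Real.pi_pos
    positivity
  · have ht : Real.tan φ < Real.pi / |Real.log lam| := by
      rw [← Real.tan_arctan (Real.pi / |Real.log lam|)]
      exact Real.tan_lt_tan_of_lt_of_lt_pi_div_two (by linarith) (Real.arctan_lt_pi_div_two _)
        (h2 h)
    rw [abs_of_neg h, Real.tan_eq_sin_div_cos, div_lt_div_iff₀ hc (by linarith)] at ht
    linarith

theorem rayIntegrand_eq (δ t lam φ R : ℝ) :
    rayIntegrand δ (1 / 2) t lam φ R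
      = halfIntegrand t lam (rayPoint (z₀ δ t) (Real.cos φ) (Real.sin φ) R)
        * (Real.cos φ + Real.sin φ * Complex.I) := by
  have he : Complex.exp (Complex.I * φ) = Real.cos φ + Real.sin φ * Complex.I := by
    rw [mul_comm, Complex.exp_mul_I]; push_cast; rfl
  rw [rayIntegrand, integrand_half, he, rayPoint]

theorem integrableOn_rayIntegrand {δ t lam φ : ℝ} (ht : 0 < t) (h0 : 0 < z₀ δ t) (h1 : z₀ δ t < 1)
    (hφ : AdmissibleAngle lam φ) :
    IntegrableOn (rayIntegrand δ (1 / 2) t lam φ) (Set.Ioi 0) := by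
  obtain ⟨hc, hs, hcs⟩ := hφ.trig
  rw [funext (rayIntegrand_eq δ t lam φ)]
  exact (integrableOn_halfIntegrand_ray ht h0 h1 hc hs hcs).mul_const _

/-- `J_B` is the difference of the limit at infinity along another ray and the value at the
endpoint of a primitive of the integrand. -/
theorem exists_primitive_tendsto {δ t lam φ k η : ℝ} (ht : 0 < t) (h0 : 0 < z₀ δ t)
    (h1 : z₀ δ t < 1) (hφ : AdmissibleAngle lam φ) (hk0 : 0 < k) (hk1 : k < 1) (hη : 0 < η)
    (hlam : 0 < Real.pi + η * Real.log lam) :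
    ∃ g : ℂ → ℂ, (∀ x : ℝ, 0 < x → x < 1 → HasDerivAt g (halfIntegrand t lam x) x) ∧
      (∀ R, 0 ≤ R → HasDerivAt g (halfIntegrand t lam (slantRay k η R)) (slantRay k η R)) ∧
      Tendsto (fun R => g (slantRay k η R)) atTop
        (nhds (g (z₀ δ t) + JB δ (1 / 2) t lam φ)) := by
  obtain ⟨hc, hd, hcd⟩ := hφ.trig
  -- Half the smaller slope puts both rays strictly inside one wedge, where a single primitive
  -- exists.
  set s := min (Real.sin φ / Real.cos φ) η / 2 with hs
  have hs0 : 0 < s := by positivity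
  have hsd : s * Real.cos φ < Real.sin φ := by
    have h2 : s < Real.sin φ / Real.cos φ :=
      (half_lt_self (by positivity)).trans_le (min_le_left _ _)
    rwa [lt_div_iff₀ hc] at h2
  have hsη : s * 1 < η := by
    rw [mul_one]; exact (half_lt_self (by positivity)).trans_le (min_le_right _ _)
  obtain ⟨g, hg⟩ := (convex_wedge s).exists_primitive (isOpen_wedge s) (f := halfIntegrand t lam)
    fun z hz => (differentiableAt_halfIntegrand t lam
      (wedge_subset_cutPlane hs0 hz)).differentiableWithinAt
  refine ⟨g, fun x hx0 hx1 => hg x (ofReal_mem_wedge hs0 hx0 hx1), fun R hR => ?_, ?_⟩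
  · rw [slantRay_eq_rayPoint]
    exact hg _ (rayPoint_mem_wedge hs0 (by linarith) (by linarith) one_pos hsη hR)
  · have hl := tendsto_primitive_ray ht h0 h1 hc hd hcd fun R hR =>
      hg _ (rayPoint_mem_wedge hs0 h0 h1 hc hsd hR)
    have hd2 := tendsto_primitive_sub ht h0 h1 (show 0 < 1 - k by linarith)
      (show 1 - k < 1 by linarith) hc hd hcd one_pos hη (by rwa [mul_one]) hg hs0 hsd hsη
    have h := hd2.add hl
    simp only [sub_add_cancel, zero_add, ← slantRay_eq_rayPoint] at h
    rw [JB, funext (rayIntegrand_eq δ t lam φ)]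
    exact h

/-! ### The neighbourhood of the endpoint -/

theorem abs_one_add_mul_log_sub_le {x : ℝ} (hx : |x| ≤ 1 / 2) :
    |(1 + x) * Real.log (1 + x) - x - x ^ 2 / 2| ≤ 4 * |x| ^ 3 := by
  have h := Real.abs_log_sub_add_sum_range_le (x := -x) (by rw [abs_neg]; linarith) 2
  simp only [Finset.sum_range_succ, Finset.sum_range_zero, abs_neg, sub_neg_eq_add] at h
  norm_num at h
  have h2 : |x| ^ 3 / (1 - |x|) ≤ 2 * |x| ^ 3 := by
    rw [div_le_iff₀ (by linarith)]
    nlinarith [pow_nonneg (abs_nonneg x) 3]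
  have e : (1 + x) * Real.log (1 + x) - x - x ^ 2 / 2
      = (1 + x) * (-x + x ^ 2 / 2 + Real.log (1 + x)) - x ^ 3 / 2 := by ring
  rw [e]
  refine (abs_sub _ _).trans ?_
  have h3 : |1 + x| ≤ 3 / 2 := by
    have := abs_le.1 hx
    exact abs_le.2 ⟨by linarith, by linarith⟩
  rw [abs_mul, abs_div, abs_pow, abs_of_pos (two_pos : (0 : ℝ) < 2)]
  have := mul_le_mul h3 (h.trans h2) (abs_nonneg _) (by norm_num)
  nlinarith [pow_nonneg (abs_nonneg x) 3]

/-- The phase on the interval `(0,1)`. -/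
noncomputable def realPhase (lam x : ℝ) : ℝ :=
  (1 - x) * Real.log (1 - x) + x * Real.log x + x * Real.log lam

theorem F_eq_realPhase {x : ℝ} (h0 : 0 ≤ x) (h1 : x ≤ 1) (lam : ℝ) :
    F x lam = (realPhase lam x : ℂ) := F_ofReal h0 h1 lam

/-- With `ρ = p/(1-p)`, the point `x = 1 - p + p s` satisfies `1 - x = p(1-s)` and `x =
(1-p)(1+ρs)`. The phase is then governed by `(1+u) log (1+u)` at `u = -s` and `u = ρs`. The
quadratic terms add to `p(1+ρ)s²/2 = ρs²/2`, and each cubic error is at most `4ps³`. -/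
theorem abs_realPhase_sub_le {p s lam : ℝ} (hp0 : 0 < p) (hp1 : p ≤ 1 / 2) (hs0 : 0 ≤ s)
    (hs1 : s ≤ 1 / 2) (hlam : 0 < lam) :
    |realPhase lam (1 - p + p * s) - (realPhase lam (1 - p)
      + p * s * Real.log (lam / (p / (1 - p))) + p / (1 - p) * s ^ 2 / 2)| ≤ 8 * p * s ^ 3 := by
  have hq : 0 < 1 - p := by linarith
  set ρ := p / (1 - p) with hρ
  have hρ0 : 0 < ρ := by positivity
  have hρ1 : ρ ≤ 1 := by rw [hρ, div_le_one hq]; linarith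
  have hqρ : (1 - p) * ρ = p := by rw [hρ]; field_simp
  have e1 : Real.log (1 - (1 - p + p * s)) = Real.log p + Real.log (1 + -s) := by
    rw [← Real.log_mul hp0.ne' (by linarith)]; congr 1; ring
  have e2 : Real.log (1 - p + p * s) = Real.log (1 - p) + Real.log (1 + ρ * s) := by
    rw [← Real.log_mul hq.ne' (by positivity)]; congr 1; linear_combination (-s) * hqρ
  have e3 : Real.log (lam / ρ) = Real.log lam - (Real.log p - Real.log (1 - p)) := by
    rw [Real.log_div hlam.ne' hρ0.ne', hρ, Real.log_div hp0.ne' hq.ne']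
  have e4 : Real.log (1 - (1 - p)) = Real.log p := by congr 1; ring
  have key : realPhase lam (1 - p + p * s) - (realPhase lam (1 - p)
      + p * s * Real.log (lam / ρ) + ρ * s ^ 2 / 2)
      = p * ((1 + -s) * Real.log (1 + -s) - -s - (-s) ^ 2 / 2)
        + (1 - p) * ((1 + ρ * s) * Real.log (1 + ρ * s) - ρ * s - (ρ * s) ^ 2 / 2) := by
    rw [realPhase, realPhase, e1, e2, e3, e4]
    linear_combination (s - s * Real.log (1 + ρ * s) + (ρ - 1) * s ^ 2 / 2) * hqρ
  rw [key]
  have h1 := abs_one_add_mul_log_sub_le (x := -s) (by rw [abs_neg, abs_of_nonneg hs0]; exact hs1)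
  have h2 := abs_one_add_mul_log_sub_le (x := ρ * s) (by
    rw [abs_of_nonneg (by positivity)]; nlinarith)
  rw [abs_neg, abs_of_nonneg hs0] at h1
  rw [abs_of_nonneg (show 0 ≤ ρ * s by positivity)] at h2
  refine (abs_add_le _ _).trans ?_
  rw [abs_mul, abs_mul, abs_of_pos hp0, abs_of_pos hq]
  have h3 : (1 - p) * (4 * (ρ * s) ^ 3) ≤ 4 * p * s ^ 3 := by
    have : (1 - p) * (4 * (ρ * s) ^ 3) = 4 * p * s ^ 3 * ρ ^ 2 := by
      linear_combination (4 * ρ ^ 2 * s ^ 3) * hqρ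
    rw [this]
    exact mul_le_of_le_one_right (by positivity) (pow_le_one₀ hρ0.le hρ1)
  have h4 := mul_le_mul_of_nonneg_left h1 hp0.le
  have h5 := mul_le_mul_of_nonneg_left h2 hq.le
  linarith

theorem norm_exp_I_mul_ofReal_sub_le (x y : ℝ) :
    ‖Complex.exp (Complex.I * x) - Complex.exp (Complex.I * y)‖ ≤ |x - y| := by
  have e : Complex.exp (Complex.I * x) - Complex.exp (Complex.I * y)
      = Complex.exp (Complex.I * y) * (Complex.exp (Complex.I * (x - y : ℝ)) - 1) := by
    rw [mul_sub, ← Complex.exp_add, mul_one]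
    congr 2
    push_cast
    ring
  rw [e, norm_mul, Complex.norm_exp_I_mul_ofReal, one_mul]
  exact Real.norm_exp_I_mul_ofReal_sub_one_le

theorem abs_rpow_neg_half_sub_one_le {s : ℝ} (hs0 : 0 ≤ s) (hs1 : s ≤ 1 / 2) :
    |(1 - s) ^ (-(1 / 2) : ℝ) - 1| ≤ s := by
  have h0 : 0 < 1 - s := by linarith
  have h1 : 1 ≤ (1 - s) ^ (-(1 / 2) : ℝ) :=
    Real.one_le_rpow_of_pos_of_le_one_of_nonpos h0 (by linarith) (by norm_num)
  rw [abs_of_nonneg (by linarith), sub_le_iff_le_add, Real.rpow_neg h0.le, ← Real.sqrt_eq_rpow]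
  refine inv_le_of_inv_le₀ (by positivity) ?_
  refine Real.le_sqrt_of_sq_le ?_
  rw [inv_pow, inv_le_comm₀ (by positivity) h0, inv_le_iff_one_le_mul₀ h0]
  -- The claim amounts to `(1-s)(1+s)² = 1 + s(1-s-s²) ≥ 1`.
  nlinarith [mul_nonneg hs0 (show 0 ≤ 1 - s - s ^ 2 by nlinarith)]

theorem halfIntegrand_near {t lam p s : ℝ} (hp0 : 0 < p) (hp1 : p ≤ 1 / 2) (hs0 : 0 ≤ s)
    (hs1 : s ≤ 1 / 2) :
    halfIntegrand t lam ((1 - p + p * s : ℝ) : ℂ) * p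
      = Real.sqrt p * (((1 - s) ^ (-(1 / 2) : ℝ) : ℝ) : ℂ)
        * Complex.exp (Complex.I * (t * realPhase lam (1 - p + p * s) : ℝ)) := by
  have h1s : 0 < 1 - s := by linarith
  have e1 : (1 - ((1 - p + p * s : ℝ) : ℂ)) ^ (-(1 / 2) : ℂ)
      = (((p * (1 - s)) ^ (-(1 / 2) : ℝ) : ℝ) : ℂ) := by
    rw [Complex.ofReal_cpow (by positivity)]
    push_cast
    congr 1
    ring
  have e2 : (p * (1 - s)) ^ (-(1 / 2) : ℝ) * p = Real.sqrt p * (1 - s) ^ (-(1 / 2) : ℝ) := by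
    have h3 : p ^ (-(1 / 2) : ℝ) * p = Real.sqrt p := by
      rw [Real.sqrt_eq_rpow]
      nth_rewrite 2 [← Real.rpow_one p]
      rw [← Real.rpow_add hp0]
      norm_num
    rw [Real.mul_rpow hp0.le h1s.le, mul_right_comm, h3]
  rw [halfIntegrand, e1, F_eq_realPhase (by nlinarith) (by nlinarith), mul_right_comm,
    ← Complex.ofReal_mul, e2]
  push_cast
  simp only [mul_assoc]

/-- The substitution `ξ = ω + s √(λ_c t/2)` turns `ξ² - ω²` into the linear and quadratic Taylor
terms of `t F`. Thus the Fresnel term is the segment integral with quadratic phase and frozen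
amplitude. -/
theorem fresnelTerm_eq {δ t lam a p : ℝ} (ht : 0 < t) (hp : p = t ^ (δ - 1)) (hp1 : p ≤ 1 / 2) :
    fresnelTerm δ t lam a = ∫ s in (0 : ℝ)..a, Real.sqrt p
      * Complex.exp (Complex.I * ((t * (realPhase lam (1 - p)
        + p * s * Real.log (lam / (p / (1 - p))) + p / (1 - p) * s ^ 2 / 2) : ℝ) : ℂ)) := by
  have hp0 : 0 < p := hp ▸ Real.rpow_pos_of_pos ht _
  have hq : 0 < 1 - p := by linarith
  have hρ : lamC δ t = p / (1 - p) := by rw [hp]; rfl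
  set ρ := p / (1 - p) with hρd
  have hρ0 : 0 < ρ := by positivity
  have hqρ : (1 - p) * ρ = p := by rw [hρd]; field_simp
  clear_value ρ
  set β := Real.sqrt (ρ * t / 2) with hβ
  have hβ0 : 0 < β := Real.sqrt_pos.2 (by positivity)
  have hβ2 : β ^ 2 = ρ * t / 2 := Real.sq_sqrt (by positivity)
  set ℓ := Real.log (lam / ρ)
  have hω : omega δ t lam = β * (ℓ * (1 - p)) := by
    have : ℓ / (1 + ρ) = ℓ * (1 - p) := by
      rw [div_eq_iff (by positivity)]
      linear_combination (-ℓ) * hqρ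
    rw [omega, bigLam, hρ, add_sub_cancel, this]
  set ω := omega δ t lam
  have hcoef : t ^ (-(1 / 2) : ℝ) * Real.sqrt (2 / (1 + ρ)) = Real.sqrt p * β⁻¹ := by
    rw [Real.rpow_neg ht.le, ← Real.sqrt_eq_rpow, hβ, ← Real.sqrt_inv, ← Real.sqrt_inv,
      ← Real.sqrt_mul (by positivity), ← Real.sqrt_mul hp0.le]
    congr 1
    have : 1 + ρ ≠ 0 := by positivity
    field_simp
    linear_combination hqρ
  have hz : z₀ δ t = 1 - p := by rw [hp]; rfl
  have hint : ∫ ξ in ω..(ω + a * β), Complex.exp (Complex.I * (ξ : ℂ) ^ 2)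
      = β * ∫ s in (0 : ℝ)..a, Complex.exp (Complex.I * ((β * s + ω : ℝ) : ℂ) ^ 2) := by
    rw [intervalIntegral.integral_comp_mul_add (fun x : ℝ => Complex.exp (Complex.I * (x : ℂ) ^ 2))
      hβ0.ne', Complex.real_smul, mul_zero, zero_add, ← mul_assoc, ← Complex.ofReal_mul,
      mul_inv_cancel₀ hβ0.ne', Complex.ofReal_one, one_mul, add_comm, mul_comm a]
  rw [fresnelTerm, hρ, ← hβ, hint, hcoef, hz, F_eq_realPhase hq.le (by linarith),
    ← mul_assoc, ← intervalIntegral.integral_const_mul]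
  refine intervalIntegral.integral_congr fun s _ => ?_
  have e1 : ((Real.sqrt p * β⁻¹ : ℝ) : ℂ) * β = Real.sqrt p := by
    rw [← Complex.ofReal_mul, mul_assoc, inv_mul_cancel₀ hβ0.ne', mul_one]
  rw [mul_assoc _ _ (β : ℂ), e1, mul_comm _ ((Real.sqrt p : ℝ) : ℂ), mul_assoc, ← Complex.exp_add]
  congr 2
  have e2 : t * (realPhase lam (1 - p) + p * s * ℓ + ρ * s ^ 2 / 2)
      = t * realPhase lam (1 - p) - ω ^ 2 + (β * s + ω) ^ 2 := by
    rw [hω]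
    linear_combination (-(s ^ 2) - 2 * s * ℓ * (1 - p)) * hβ2 - t * s * ℓ * hqρ
  rw [e2]
  push_cast
  ring

theorem norm_near_sub_fresnelTerm_le {δ t lam a p : ℝ} (ht : 0 < t) (hp : p = t ^ (δ - 1))
    (hp1 : p ≤ 1 / 2) (hlam : 0 < lam) (ha0 : 0 < a) (ha1 : a ≤ 1 / 2) (hta : 1 ≤ t * p * a ^ 2)
    {g : ℂ → ℂ} (hg : ∀ x : ℝ, 0 < x → x < 1 → HasDerivAt g (halfIntegrand t lam x) x) :
    ‖g ((1 - p + p * a : ℝ) : ℂ) - g ((1 - p : ℝ) : ℂ) - fresnelTerm δ t lam a‖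
      ≤ 9 * (Real.sqrt p * (t * p) * a ^ 4) := by
  have hp0 : 0 < p := hp ▸ Real.rpow_pos_of_pos ht _
  have huIcc : Set.uIcc (0 : ℝ) a = Set.Icc 0 a := Set.uIcc_of_le ha0.le
  have hd : ∀ s ∈ Set.uIcc (0 : ℝ) a, HasDerivAt (fun s : ℝ => g ((1 - p + p * s : ℝ) : ℂ))
      (halfIntegrand t lam ((1 - p + p * s : ℝ) : ℂ) * p) s := fun s hs => by
    rw [huIcc] at hs
    have h1 : HasDerivAt (fun s : ℝ => ((1 - p + p * s : ℝ) : ℂ)) (p : ℂ) s := by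
      have := (((hasDerivAt_id s).const_mul p).const_add (1 - p)).ofReal_comp
      simpa using this
    have h2 := hg (1 - p + p * s) (by nlinarith [hs.1]) (by nlinarith [hs.2])
    exact HasDerivAt.comp (h₂ := g) (h := fun s : ℝ => ((1 - p + p * s : ℝ) : ℂ)) s h2 h1
  have hcont : ContinuousOn (fun s : ℝ => halfIntegrand t lam ((1 - p + p * s : ℝ) : ℂ) * p)
      (Set.uIcc 0 a) := by
    intro s hs
    rw [huIcc] at hs
    have hmem : ((1 - p + p * s : ℝ) : ℂ) ∈ cutPlane :=
      ofReal_mem_cutPlane (by nlinarith [hs.1]) (by nlinarith [hs.2])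
    have h2 : ContinuousAt (fun s : ℝ => ((1 - p + p * s : ℝ) : ℂ)) s := by fun_prop
    exact ((ContinuousAt.comp (f := fun s : ℝ => ((1 - p + p * s : ℝ) : ℂ))
      (differentiableAt_halfIntegrand t lam hmem).continuousAt h2).mul_const _).continuousWithinAt
  have hint := intervalIntegral.integral_eq_sub_of_hasDerivAt hd hcont.intervalIntegrable
  simp only [mul_zero, add_zero] at hint
  rw [← hint, fresnelTerm_eq ht hp hp1, ← intervalIntegral.integral_sub hcont.intervalIntegrable
    (Continuous.intervalIntegrable (by fun_prop) _ _)]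
  have hbound : ∀ s ∈ Set.uIoc (0 : ℝ) a, ‖halfIntegrand t lam ((1 - p + p * s : ℝ) : ℂ) * p
      - Real.sqrt p * Complex.exp (Complex.I * ((t * (realPhase lam (1 - p)
        + p * s * Real.log (lam / (p / (1 - p))) + p / (1 - p) * s ^ 2 / 2) : ℝ) : ℂ))‖
      ≤ Real.sqrt p * (a + 8 * (t * p) * a ^ 3) := by
    intro s hs
    rw [Set.uIoc_of_le ha0.le] at hs
    have hs1 : s ≤ 1 / 2 := hs.2.trans ha1
    rw [halfIntegrand_near hp0 hp1 hs.1.le hs1]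
    set X := t * realPhase lam (1 - p + p * s)
    set Y := t * (realPhase lam (1 - p)
        + p * s * Real.log (lam / (p / (1 - p))) + p / (1 - p) * s ^ 2 / 2)
    set r := (1 - s) ^ (-(1 / 2) : ℝ)
    have e : (Real.sqrt p : ℂ) * (r : ℂ) * Complex.exp (Complex.I * X)
        - Real.sqrt p * Complex.exp (Complex.I * Y)
        = Real.sqrt p * ((r - 1 : ℝ) * Complex.exp (Complex.I * X)
          + (Complex.exp (Complex.I * X) - Complex.exp (Complex.I * Y))) := by
      push_cast; ring
    rw [e, norm_mul, Complex.norm_real, Real.norm_of_nonneg (Real.sqrt_nonneg p)]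
    refine mul_le_mul_of_nonneg_left ((norm_add_le _ _).trans (add_le_add ?_ ?_))
      (Real.sqrt_nonneg p)
    · rw [norm_mul, Complex.norm_exp_I_mul_ofReal, mul_one, Complex.norm_real]
      exact (abs_rpow_neg_half_sub_one_le hs.1.le hs1).trans hs.2
    · refine (norm_exp_I_mul_ofReal_sub_le X Y).trans ?_
      rw [← mul_sub, abs_mul, abs_of_pos ht]
      calc t * _ ≤ t * (8 * p * s ^ 3) := by
            gcongr
            exact abs_realPhase_sub_le hp0 hp1 hs.1.le hs1 hlam
        _ ≤ t * (8 * p * a ^ 3) := by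
            have := hs.1.le
            have := hs.2
            gcongr
        _ = _ := by ring
  refine (intervalIntegral.norm_integral_le_of_norm_le_const hbound).trans ?_
  rw [sub_zero, abs_of_pos ha0, mul_assoc,
    show 9 * (Real.sqrt p * (t * p) * a ^ 4) = Real.sqrt p * (9 * (t * p * a ^ 4)) by ring]
  refine mul_le_mul_of_nonneg_left ?_ (Real.sqrt_nonneg p)
  -- The amplitude error `a²` is at most `t p a⁴` since `t p a² ≥ 1`; with the phase error this
  -- gives `1 + 8 = 9`.
  nlinarith [mul_le_mul_of_nonneg_left hta (sq_nonneg a)]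

/-! ### The tail -/

theorem exists_norm_iterate_slantRay_le (j : ℕ) : ∃ K : ℝ, 0 ≤ K ∧ ∀ t lam k η b : ℝ, 0 < t →
    0 < k → k ≤ 1 / 2 → 0 < η → η ≤ 1 → 0 < b → b ≤ 1 →
    b ≤ Real.log (1 - k) - Real.log k + Real.log lam → ∀ R, 0 ≤ R →
    ‖(ibpOp t lam)^[j] (ibpStart t lam) (slantRay k η R)‖ * (1 + ‖dF lam (slantRay k η R)‖)
      ≤ K * t⁻¹ ^ (j + 1) * (η * k / 2) ^ (-(1 / 2) : ℝ) * (η * k / 2)⁻¹ ^ j * b⁻¹ ^ (2 * j + 1) := by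
  obtain ⟨K, hK0, hK⟩ := exists_norm_ibpClosed_le j
  refine ⟨K, hK0, fun t lam k η b ht hk0 hk1 hη hη1 hb0 hb1 hb R hR => ?_⟩
  have hmem := slantRay_mem_cutPlane hk0 hk1 hη hR
  have hw := le_norm_dF_slantRay hk0 hk1 hη hη1 hb1 hb hR
  have hreg : slantRay k η R ∈ regularSet lam := ⟨hmem, norm_pos_iff.1 (hb0.trans_le hw)⟩
  have h1 := hK lam b _ hmem (half_le_norm_slantRay hk1 hR) hb0 hb1 hw
  have h2 := le_norm_one_sub_slantRay hk0 hη hη1 R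
  have h3 : 0 < η * k / 2 := by positivity
  have h4 : ‖1 - slantRay k η R‖ ^ (-(1 / 2) : ℝ) ≤ (η * k / 2) ^ (-(1 / 2) : ℝ) :=
    Real.rpow_le_rpow_of_nonpos h3 h2 (by norm_num)
  have h5 : ‖1 - slantRay k η R‖⁻¹ ≤ (η * k / 2)⁻¹ := inv_anti₀ h3 h2
  rw [norm_iterate_ibpOp ht j hreg, mul_assoc]
  calc _ ≤ t⁻¹ ^ (j + 1) * (K * (η * k / 2) ^ (-(1 / 2) : ℝ) * (η * k / 2)⁻¹ ^ j
        * b⁻¹ ^ (2 * j + 1)) := by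
        refine mul_le_mul_of_nonneg_left (h1.trans ?_) (by positivity)
        gcongr
    _ = _ := by ring

theorem tendsto_four_div_sq : Tendsto (fun R : ℝ => 4 / (1 + R) ^ 2) atTop (nhds 0) := by
  refine Tendsto.div_atTop tendsto_const_nhds ?_
  exact (tendsto_pow_atTop two_ne_zero).comp (tendsto_atTop_add_const_left _ 1 tendsto_id)

theorem norm_sub_le_of_norm_deriv_le_div_sq {f f' : ℝ → ℂ} {M : ℝ}
    (hf : ∀ R, 0 ≤ R → HasDerivAt f (f' R) R) (hM : ∀ R, 0 ≤ R → ‖f' R‖ ≤ M / (1 + R) ^ 2)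
    {R : ℝ} (hR : 0 ≤ R) : ‖f R - f 0‖ ≤ M := by
  have hM0 : 0 ≤ M := by
    have := (norm_nonneg _).trans (hM 0 le_rfl)
    simpa using this
  -- The comparison function `M - M/(1+x)` is the primitive of the bound and never exceeds `M`.
  have h := image_norm_le_of_norm_deriv_right_le_deriv_boundary' (a := 0) (b := R)
    (f := fun x => f x - f 0) (f' := f') (B := fun x => M - M / (1 + x))
    (B' := fun x => M / (1 + x) ^ 2)
    (fun x hx => ((hf x hx.1).sub_const _).continuousAt.continuousWithinAt)
    (fun x hx => ((hf x hx.1).sub_const _).hasDerivWithinAt) (by simp)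
    (fun x hx => by
      have : 1 + x ≠ 0 := by have := hx.1; positivity
      exact (ContinuousAt.sub continuousAt_const (ContinuousAt.div continuousAt_const
        (by fun_prop) this)).continuousWithinAt)
    (fun x hx => by
      have : 1 + x ≠ 0 := by have := hx.1; positivity
      have h1 := (((hasDerivAt_id x).const_add 1).inv this).const_mul M |>.const_sub M
      refine (h1.congr_deriv ?_).hasDerivWithinAt.congr_of_eventuallyEq ?_ ?_
      · simp only [id]; field_simp
      · exact Filter.Eventually.of_forall fun y => by simp [div_eq_mul_inv]
      · simp [div_eq_mul_inv])
    (fun x hx => hM x hx.1) (Set.right_mem_Icc.2 hR)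
  refine h.trans (sub_le_self _ ?_)
  positivity

/-- The integral over the tail is a sum of boundary terms up to a remainder. -/
theorem exists_norm_tail_le (N : ℕ) : ∃ K : ℝ, 0 ≤ K ∧ ∀ t lam k η b : ℝ, 2 ≤ t →
    0 < k → k ≤ 1 / 2 → 0 < η → η ≤ 1 → -1 ≤ η * Real.log lam → 0 < b → b ≤ 1 →
    b ≤ Real.log (1 - k) - Real.log k + Real.log lam → ∀ (g : ℂ → ℂ) (L : ℂ),
    (∀ R, 0 ≤ R → HasDerivAt g (halfIntegrand t lam (slantRay k η R)) (slantRay k η R)) →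
    Tendsto (fun R => g (slantRay k η R)) atTop (nhds L) →
    ‖L - g ((1 - k : ℝ) : ℂ) - ∑ j ∈ Finset.range N, T t lam k j‖
      ≤ K * t⁻¹ ^ N * (η * k / 2) ^ (-(1 / 2) : ℝ) * (η * k / 2)⁻¹ ^ N * b⁻¹ ^ (2 * N + 1) := by
  choose K hK0 hK using exists_norm_iterate_slantRay_le
  refine ⟨8 * K N, by linarith [hK0 N],
    fun t lam k η b ht2 hk0 hk1 hη hη1 hlam hb0 hb1 hb g L hg hL => ?_⟩
  have ht : 0 < t := by linarith
  have hv : ‖(1 : ℂ) + η * Complex.I‖ ≤ 2 := by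
    refine (norm_add_le _ _).trans ?_
    rw [norm_one, norm_mul, Complex.norm_I, mul_one, Complex.norm_real,
      Real.norm_of_nonneg hη.le]
    linarith
  set E : ℂ → ℂ := fun z => Complex.exp (Complex.I * t * F z lam) with hE
  have hEb : ∀ R, 0 ≤ R → ‖E (slantRay k η R)‖ ≤ 4 / (1 + R) ^ 2 := fun R hR =>
    norm_exp_phase_slantRay_le hk0 hk1 hη hη1 hlam (hb0.le.trans hb) ht2 hR
  have hreg : ∀ R, 0 ≤ R → slantRay k η R ∈ regularSet lam := fun R hR =>
    ⟨slantRay_mem_cutPlane hk0 hk1 hη hR, norm_pos_iff.1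
      (hb0.trans_le (le_norm_dF_slantRay hk0 hk1 hη hη1 hb1 hb hR))⟩
  set G : ℕ → ℂ → ℂ := fun j => (ibpOp t lam)^[j] (ibpStart t lam) with hG
  set S : ℂ → ℂ := fun z => (∑ j ∈ Finset.range N, G j z) * E z with hS
  set D := (η * k / 2) ^ (-(1 / 2) : ℝ) * (η * k / 2)⁻¹ ^ N * b⁻¹ ^ (2 * N + 1) with hD
  have hD0 : 0 ≤ D := by positivity
  have hGb : ∀ j R, 0 ≤ R → ‖G j (slantRay k η R)‖ * (1 + ‖dF lam (slantRay k η R)‖)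
      ≤ K j * t⁻¹ ^ (j + 1) * (η * k / 2) ^ (-(1 / 2) : ℝ) * (η * k / 2)⁻¹ ^ j
        * b⁻¹ ^ (2 * j + 1) := fun j R hR => hK j t lam k η b ht hk0 hk1 hη hη1 hb0 hb1 hb R hR
  -- Subtracting the boundary sum `S` from the primitive leaves only the `N`-th remainder. `S`
  -- vanishes at infinity and equals minus the sum of the `T_j` at `R = 0`.
  have hder : ∀ R, 0 ≤ R → HasDerivAt (fun R => g (slantRay k η R) - S (slantRay k η R))
      (G N (slantRay k η R) * (Complex.I * t * dF lam (slantRay k η R)) * E (slantRay k η R)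
        * (1 + η * Complex.I)) R := fun R hR => by
    have h1 := (hg R hR).sub (hasDerivAt_sum_ibp ht.ne' N (hreg R hR))
    refine (h1.comp R (hasDerivAt_slantRay k η R)).congr_deriv ?_
    rw [halfIntegrand, sub_sub_cancel]
  have hderb : ∀ R, 0 ≤ R →
      ‖G N (slantRay k η R) * (Complex.I * t * dF lam (slantRay k η R)) * E (slantRay k η R)
        * (1 + η * Complex.I)‖ ≤ (8 * K N * t⁻¹ ^ N * D) / (1 + R) ^ 2 := fun R hR => by
    have h1 := hGb N R hR
    have h2 : ‖G N (slantRay k η R)‖ * ‖dF lam (slantRay k η R)‖ ≤ K N * t⁻¹ ^ (N + 1) * D := by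
      refine le_trans ?_ (h1.trans_eq (by rw [hD]; ring))
      gcongr
      linarith
    calc _ = t * (‖G N (slantRay k η R)‖ * ‖dF lam (slantRay k η R)‖) * ‖E (slantRay k η R)‖
          * ‖(1 : ℂ) + η * Complex.I‖ := by
          simp only [norm_mul, Complex.norm_I, Complex.norm_real, Real.norm_of_nonneg ht.le]; ring
      _ ≤ t * (K N * t⁻¹ ^ (N + 1) * D) * (4 / (1 + R) ^ 2) * 2 := by
          have := hK0 N
          gcongr
          exact hEb R hR
      _ = (t * t⁻¹) * (8 * K N * t⁻¹ ^ N * D) / (1 + R) ^ 2 := by ring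
      _ = _ := by rw [mul_inv_cancel₀ ht.ne', one_mul]
  have hSlim : Tendsto (fun R => S (slantRay k η R)) atTop (nhds 0) := by
    have : Tendsto (fun R => ∑ j ∈ Finset.range N, G j (slantRay k η R) * E (slantRay k η R))
        atTop (nhds (∑ j ∈ Finset.range N, (0 : ℂ))) := by
      refine tendsto_finsetSum _ fun j _ => ?_
      set B := K j * t⁻¹ ^ (j + 1) * (η * k / 2) ^ (-(1 / 2) : ℝ) * (η * k / 2)⁻¹ ^ j
        * b⁻¹ ^ (2 * j + 1) with hB
      have hB0 : 0 ≤ B := by have := hK0 j; positivity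
      refine squeeze_zero_norm' (a := fun R => B * (4 / (1 + R) ^ 2)) ?_
        (by simpa using tendsto_four_div_sq.const_mul B)
      filter_upwards [eventually_ge_atTop 0] with R hR
      rw [norm_mul]
      have h1 : ‖G j (slantRay k η R)‖ ≤ B := by
        refine le_trans ?_ (hGb j R hR)
        exact le_mul_of_one_le_right (norm_nonneg _) (by linarith [norm_nonneg (dF lam (slantRay k η R))])
      exact mul_le_mul h1 (hEb R hR) (norm_nonneg _) hB0
    simpa [hS, Finset.sum_mul] using this
  have hlim := (hL.sub hSlim).sub_const
    (g (slantRay k η 0) - S (slantRay k η 0)) |>.norm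
  have hle := le_of_tendsto hlim (by
    filter_upwards [eventually_ge_atTop 0] with R hR
    exact norm_sub_le_of_norm_deriv_le_div_sq hder hderb hR)
  refine le_trans (le_of_eq ?_) (hle.trans_eq (by rw [hD]; ring))
  congr 1
  have hST : S (slantRay k η 0) = -∑ j ∈ Finset.range N, T t lam k j := by
    rw [slantRay_zero, hS, ← Finset.sum_neg_distrib]
    simp only [T, hG, hE, Finset.sum_mul]
    push_cast
    simp
  rw [hST, slantRay_zero]
  ring

/-! ### The boundary terms -/

theorem exists_norm_T_le (j : ℕ) : ∃ K : ℝ, 0 ≤ K ∧ ∀ t lam k b : ℝ, 0 < t →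
    0 < k → k ≤ 1 / 2 → 0 < b → b ≤ 1 →
    b ≤ Real.log (1 - k) - Real.log k + Real.log lam →
    ‖T t lam k j‖ ≤ t⁻¹ ^ (j + 1) * (k ^ (-(1 / 2) : ℝ) * k⁻¹ ^ j * b⁻¹ ^ (2 * j + 1)
      * ((1 - k)⁻¹ ^ j * (Nat.doubleFactorial (2 * j - 1) : ℝ) + K * b)) := by
  obtain ⟨K, hK0, hK⟩ := exists_norm_ibpClosed_le_leading j
  refine ⟨K, hK0, fun t lam k b ht hk0 hk1 hb0 hb1 hb => ?_⟩
  have hmem : ((1 - k : ℝ) : ℂ) ∈ cutPlane := ofReal_mem_cutPlane (by linarith) (by linarith)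
  have hdF : dF lam ((1 - k : ℝ) : ℂ) = ((Real.log (1 - k) - Real.log k + Real.log lam : ℝ) : ℂ) := by
    rw [dF_ofReal (by linarith) (by linarith), sub_sub_cancel]
  have hw : b ≤ ‖dF lam ((1 - k : ℝ) : ℂ)‖ := by
    rw [hdF, Complex.norm_real]; exact hb.trans (le_abs_self _)
  have hreg : ((1 - k : ℝ) : ℂ) ∈ regularSet lam := ⟨hmem, norm_pos_iff.1 (hb0.trans_le hw)⟩
  have hn : ‖((1 - k : ℝ) : ℂ)‖ = 1 - k := by
    rw [Complex.norm_real, Real.norm_of_nonneg (by linarith)]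
  have hn' : ‖1 - ((1 - k : ℝ) : ℂ)‖ = k := by
    rw [show (1 : ℂ) - ((1 - k : ℝ) : ℂ) = (k : ℂ) by push_cast; ring, Complex.norm_real,
      Real.norm_of_nonneg hk0.le]
  have h := hK lam b _ hmem (by rw [hn]; linarith) hb0 hb1 hw
  rw [hn, hn'] at h
  have hE : ‖Complex.exp (Complex.I * t * F ((1 - k : ℝ) : ℂ) lam)‖ = 1 := by
    rw [norm_exp_phase, F_ofReal (by linarith) (by linarith), Complex.ofReal_im]; simp
  have hc : (1 : ℂ) - k = ((1 - k : ℝ) : ℂ) := by push_cast; rfl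
  rw [T, hc, norm_mul, hE, mul_one, norm_neg, norm_iterate_ibpOp ht j hreg]
  exact mul_le_mul_of_nonneg_left h (by positivity)

/-! ### Orders of magnitude -/

theorem boundT_eq {δ t a : ℝ} (ht : 0 < t) (ha : 0 < a) (j : ℕ) :
    boundT δ j t a = (Nat.doubleFactorial (2 * j - 1) : ℝ)
      * (t ^ (-(1 / 2) : ℝ) * (a * t ^ (δ / 2))⁻¹ ^ (2 * j + 1)) := by
  -- Writing `t = e^u` and `a = e^v` reduces the identity to one between exponents.
  obtain ⟨u, rfl⟩ : ∃ u, t = Real.exp u := ⟨Real.log t, (Real.exp_log ht).symm⟩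
  obtain ⟨v, rfl⟩ : ∃ v, a = Real.exp v := ⟨Real.log a, (Real.exp_log ha).symm⟩
  rw [boundT, mul_assoc]
  congr 1
  simp only [← Real.exp_mul, ← Real.exp_add, ← Real.exp_neg, ← Real.exp_nat_mul]
  congr 1
  push_cast
  ring

theorem inv_pow_mul_eq {δ t a : ℝ} (ht : 0 < t) (ha : 0 < a) (j : ℕ) :
    t⁻¹ ^ (j + 1) * ((t ^ (δ - 1)) ^ (-(1 / 2) : ℝ) * (t ^ (δ - 1))⁻¹ ^ j * a⁻¹ ^ (2 * j + 1))
      = t ^ (-(1 / 2) : ℝ) * (a * t ^ (δ / 2))⁻¹ ^ (2 * j + 1) := by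
  obtain ⟨u, rfl⟩ : ∃ u, t = Real.exp u := ⟨Real.log t, (Real.exp_log ht).symm⟩
  obtain ⟨v, rfl⟩ : ∃ v, a = Real.exp v := ⟨Real.log a, (Real.exp_log ha).symm⟩
  simp only [← Real.exp_mul, ← Real.exp_add, ← Real.exp_neg, ← Real.exp_nat_mul]
  congr 1
  push_cast
  ring

theorem err₁_eq {δ t a : ℝ} (ht : 0 < t) (ha : 0 < a) {m : ℕ} (hm : 1 ≤ m) :
    err₁ δ m t a = (Nat.doubleFactorial (4 * m - 5) : ℝ)
      * (t ^ (-(1 / 2) : ℝ) * t ^ (δ / 2) * (a * t ^ (δ / 2))⁻¹ ^ (4 * m - 4))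
      * Real.log t ^ ((4 * (m : ℝ) - 3) / 2) := by
  rw [err₁, mul_right_comm, mul_assoc (Nat.doubleFactorial (4 * m - 5) : ℝ)]
  congr 2
  obtain ⟨u, rfl⟩ : ∃ u, t = Real.exp u := ⟨Real.log t, (Real.exp_log ht).symm⟩
  obtain ⟨v, rfl⟩ : ∃ v, a = Real.exp v := ⟨Real.log a, (Real.exp_log ha).symm⟩
  simp only [← Real.exp_mul, ← Real.exp_add, ← Real.exp_neg, ← Real.exp_nat_mul]
  congr 1
  rw [Nat.cast_sub (by omega)]
  push_cast
  ring

theorem err₂_eq {δ t a : ℝ} (ht : 0 < t) :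
    err₂ δ t a = Real.sqrt (t ^ (δ - 1)) * (t * t ^ (δ - 1)) * a ^ 4 := by
  rw [err₂, Real.sqrt_eq_rpow]
  congr 1
  obtain ⟨u, rfl⟩ : ∃ u, t = Real.exp u := ⟨Real.log t, (Real.exp_log ht).symm⟩
  simp only [← Real.exp_mul, ← Real.exp_add]
  congr 1
  ring

theorem mul_rpow_mul_sq_eq {δ t a : ℝ} (ht : 0 < t) :
    t * t ^ (δ - 1) * a ^ 2 = (a * t ^ (δ / 2)) ^ 2 := by
  rw [mul_pow, mul_comm (a ^ 2)]
  congr 1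
  obtain ⟨u, rfl⟩ : ∃ u, t = Real.exp u := ⟨Real.log t, (Real.exp_log ht).symm⟩
  simp only [← Real.exp_mul, ← Real.exp_add, ← Real.exp_nat_mul]
  congr 1
  push_cast
  ring

/-! ### Facts about the parameters for fixed `t` -/

theorem log_lamC_le {δ t lam : ℝ} (hp0 : 0 < t ^ (δ - 1)) (hp1 : t ^ (δ - 1) ≤ 1 / 2)
    (hlam : t ^ (δ - 1) / (1 - t ^ (δ - 1)) ≤ lam) :
    Real.log (t ^ (δ - 1)) - Real.log (1 - t ^ (δ - 1)) ≤ Real.log lam := by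
  rw [← Real.log_div hp0.ne' (by linarith)]
  exact Real.log_le_log (div_pos hp0 (by linarith)) hlam

/-- At `λ = λ_c` the phase is stationary at `1 - t^(δ-1)`. Moving to `1 - k` raises `F'` by at least
`-log (1-a) ≥ a`, and a larger `λ` only adds to it. -/
theorem le_log_splitK {δ t a lam : ℝ} (hp0 : 0 < t ^ (δ - 1)) (hp1 : t ^ (δ - 1) ≤ 1 / 2)
    (ha0 : 0 < a) (ha1 : a ≤ 1 / 2) (hlam : t ^ (δ - 1) / (1 - t ^ (δ - 1)) ≤ lam) :
    a ≤ Real.log (1 - splitK δ t a) - Real.log (splitK δ t a) + Real.log lam := by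
  have h1 := log_lamC_le hp0 hp1 hlam
  have h2 : Real.log (splitK δ t a) = Real.log (t ^ (δ - 1)) + Real.log (1 - a) :=
    Real.log_mul hp0.ne' (by linarith)
  have h3 : Real.log (1 - t ^ (δ - 1)) ≤ Real.log (1 - splitK δ t a) := by
    refine Real.log_le_log (by linarith) ?_
    rw [splitK]
    nlinarith
  have h4 := Real.log_le_sub_one_of_pos (show 0 < 1 - a by linarith)
  linarith

theorem splitK_pos {δ t a : ℝ} (hp0 : 0 < t ^ (δ - 1)) (ha1 : a ≤ 1 / 2) : 0 < splitK δ t a :=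
  mul_pos hp0 (by linarith)

theorem splitK_le {δ t a : ℝ} (hp0 : 0 < t ^ (δ - 1)) (hp1 : t ^ (δ - 1) ≤ 1 / 2)
    (ha0 : 0 < a) : splitK δ t a ≤ 1 / 2 := by
  rw [splitK]; nlinarith

theorem half_le_splitK {δ t a : ℝ} (hp0 : 0 < t ^ (δ - 1)) (ha1 : a ≤ 1 / 2) :
    t ^ (δ - 1) / 2 ≤ splitK δ t a := by
  rw [splitK]; nlinarith

/-! ### Uniform bounds for large `t` -/

theorem tendsto_rpow_sub_one {δ : ℝ} (hδ1 : δ < 1) :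
    Tendsto (fun t : ℝ => t ^ (δ - 1)) atTop (nhds 0) := by
  simpa using tendsto_rpow_neg_atTop (show 0 < 1 - δ by linarith)

theorem eventually_norm_T_le {δ : ℝ} (hδ1 : δ < 1) {a : ℝ → ℝ} (ha : ∀ᶠ t in atTop, 0 < a t)
    (ha0 : Tendsto a atTop (nhds 0)) (j : ℕ) :
    ∀ᶠ t in atTop, ∀ lam : ℝ, t ^ (δ - 1) / (1 - t ^ (δ - 1)) ≤ lam →
      ‖T t lam (splitK δ t (a t)) j‖ ≤ 2 * boundT δ j t (a t) := by
  obtain ⟨K, hK0, hK⟩ := exists_norm_T_le j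
  have hp := tendsto_rpow_sub_one hδ1
  set d : ℝ := (Nat.doubleFactorial (2 * j - 1) : ℝ) with hd
  have hd1 : 0 < d := by
    rw [hd]; exact_mod_cast Nat.doubleFactorial_pos _
  have hk : Tendsto (fun t => splitK δ t (a t)) atTop (nhds 0) := by
    simpa [splitK] using hp.mul (ha0.const_sub 1)
  have h1a : Tendsto (fun t => 1 - a t) atTop (nhds 1) := by simpa using ha0.const_sub 1
  have h1k : Tendsto (fun t => 1 - splitK δ t (a t)) atTop (nhds 1) := by
    simpa using hk.const_sub 1
  -- The ratio to the leading term tends to the double factorial itself, so the factor `2` works for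
  -- every `j` at the price of a threshold depending on `j`.
  have hlim : Tendsto (fun t => (1 - a t) ^ (-(1 / 2) : ℝ) * (1 - a t)⁻¹ ^ j
      * ((1 - splitK δ t (a t))⁻¹ ^ j * d + K * a t)) atTop (nhds d) := by
    have h := (((h1a.rpow_const (p := (-(1 / 2) : ℝ)) (Or.inl one_ne_zero)).mul
      ((h1a.inv₀ one_ne_zero).pow j)).mul
      ((((h1k.inv₀ one_ne_zero).pow j).mul_const d).add (ha0.const_mul K)))
    simpa using h
  filter_upwards [ha, ha0.eventually_le_const (show (0 : ℝ) < 1 / 2 by norm_num),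
    hp.eventually_le_const (show (0 : ℝ) < 1 / 2 by norm_num), eventually_gt_atTop 0,
    hlim.eventually_le_const (show d < 2 * d by linarith)] with t hat hat1 hp1 ht hle lam hlam
  have hp0 : 0 < t ^ (δ - 1) := Real.rpow_pos_of_pos ht _
  refine (hK t lam _ (a t) ht (splitK_pos hp0 hat1) (splitK_le hp0 hp1 hat) hat (by linarith)
    (le_log_splitK hp0 hp1 hat hat1 hlam)).trans ?_
  rw [boundT_eq ht hat, ← inv_pow_mul_eq ht hat, ← hd]
  have e : splitK δ t (a t) ^ (-(1 / 2) : ℝ) * (splitK δ t (a t))⁻¹ ^ j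
      = (t ^ (δ - 1)) ^ (-(1 / 2) : ℝ) * (t ^ (δ - 1))⁻¹ ^ j
        * ((1 - a t) ^ (-(1 / 2) : ℝ) * (1 - a t)⁻¹ ^ j) := by
    rw [splitK, Real.mul_rpow hp0.le (by linarith), mul_inv, mul_pow]
    ring
  rw [e]
  calc _ = t⁻¹ ^ (j + 1) * ((t ^ (δ - 1)) ^ (-(1 / 2) : ℝ) * (t ^ (δ - 1))⁻¹ ^ j
          * (a t)⁻¹ ^ (2 * j + 1)) * ((1 - a t) ^ (-(1 / 2) : ℝ) * (1 - a t)⁻¹ ^ j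
          * ((1 - splitK δ t (a t))⁻¹ ^ j * d + K * a t)) := by ring
    _ ≤ t⁻¹ ^ (j + 1) * ((t ^ (δ - 1)) ^ (-(1 / 2) : ℝ) * (t ^ (δ - 1))⁻¹ ^ j
          * (a t)⁻¹ ^ (2 * j + 1)) * (2 * d) := mul_le_mul_of_nonneg_left hle (by positivity)
    _ = _ := by ring

/-- Apart from the gain `y^(-2N)`, the losses are crudely `t` for the logarithms and constants, `t`
for `p⁻¹` and `t^(1/2)` for `a⁻¹`. The surplus `y^(2N-n) ≥ t⁴` more than covers them and the factor
`t^(-1/2)`. -/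
theorem eventually_remainder_le {δ γ : ℝ} (hδ1 : δ < 1) (hδ0 : 0 < δ) (hγ : 0 < γ) {a : ℝ → ℝ}
    (ha : ∀ᶠ t in atTop, 0 < a t) (ha0 : Tendsto a atTop (nhds 0))
    (hy : ∀ᶠ t in atTop, t ^ γ ≤ a t * t ^ (δ / 2)) (K : ℝ) (hK : 0 ≤ K) (n N : ℕ)
    (hN : 4 ≤ γ * (2 * (N : ℝ) - n)) (hnN : n ≤ 2 * N) :
    ∀ᶠ t in atTop,
      K * t⁻¹ ^ N * ((Real.log t)⁻¹ * splitK δ t (a t) / 2) ^ (-(1 / 2) : ℝ)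
        * ((Real.log t)⁻¹ * splitK δ t (a t) / 2)⁻¹ ^ N * (a t)⁻¹ ^ (2 * N + 1)
      ≤ t ^ (-(1 / 2) : ℝ) * (a t * t ^ (δ / 2))⁻¹ ^ n := by
  have hp := tendsto_rpow_sub_one hδ1
  have hlog : ∀ᶠ t : ℝ in atTop, K * 4 ^ (N + 1) * Real.log t ^ (N + 1) ≤ t := by
    have h := (Real.isLittleO_pow_log_id_atTop (n := N + 1)).bound
      (c := (K * 4 ^ (N + 1) + 1)⁻¹) (by positivity)
    filter_upwards [h, eventually_ge_atTop 1] with t h1 ht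
    have hlt : 0 ≤ Real.log t := Real.log_nonneg ht
    rw [id, Real.norm_of_nonneg (by positivity), Real.norm_of_nonneg (by linarith),
      ← div_eq_inv_mul, le_div_iff₀ (by positivity)] at h1
    nlinarith [pow_nonneg hlt (N + 1)]
  filter_upwards [ha, ha0.eventually_le_const (show (0 : ℝ) < 1 / 2 by norm_num),
    hp.eventually_le_const (show (0 : ℝ) < 1 / 2 by norm_num), eventually_ge_atTop 1,
    hy, hlog, Real.tendsto_log_atTop.eventually_ge_atTop 1] with t hat hat1 hp1 ht1 hyt hlt hL
  have ht : 0 < t := by linarith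
  set p := t ^ (δ - 1) with hpd
  have hp0 : 0 < p := Real.rpow_pos_of_pos ht _
  set L := Real.log t
  set y := a t * t ^ (δ / 2) with hyd
  have hy1 : 1 ≤ y := (Real.one_le_rpow ht1 hγ.le).trans hyt
  have hy0 : 0 < y := by linarith
  set x := L⁻¹ * splitK δ t (a t) / 2 with hx
  have hx0 : 0 < x := by
    have := splitK_pos (δ := δ) hp0 hat1
    positivity
  have hx1 : x ≤ 1 := by
    have h1 := splitK_le hp0 hp1 hat
    have h2 : L⁻¹ ≤ 1 := inv_le_one_of_one_le₀ hL
    have h3 : L⁻¹ * splitK δ t (a t) ≤ 1 * (1 / 2) :=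
      mul_le_mul h2 h1 (splitK_pos hp0 hat1).le zero_le_one
    rw [hx]; linarith
  have hxi : x⁻¹ ≤ 4 * L * p⁻¹ := by
    rw [inv_le_iff_one_le_mul₀ hx0]
    have h1 := half_le_splitK (δ := δ) (t := t) hp0 hat1
    have h2 : 4 * L * p⁻¹ * x = 2 * p⁻¹ * splitK δ t (a t) * (L * L⁻¹) := by rw [hx]; ring
    rw [h2, mul_inv_cancel₀ (by linarith), mul_one]
    have h3 : 2 * p⁻¹ * (p / 2) = 1 := by field_simp
    rw [← h3]
    gcongr
  have hxr : x ^ (-(1 / 2) : ℝ) ≤ x⁻¹ := by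
    rw [← Real.rpow_neg_one]
    exact Real.rpow_le_rpow_of_exponent_ge hx0 hx1 (by norm_num)
  have hpi : p⁻¹ ≤ t := by
    rw [hpd, ← Real.rpow_neg ht.le]
    calc t ^ (-(δ - 1)) ≤ t ^ (1 : ℝ) := Real.rpow_le_rpow_of_exponent_le ht1 (by linarith)
      _ = t := Real.rpow_one t
  have hai : (a t)⁻¹ ≤ t ^ (1 / 2 : ℝ) := by
    rw [inv_le_iff_one_le_mul₀ hat]
    calc 1 ≤ y := hy1
      _ = t ^ (δ / 2) * a t := mul_comm _ _
      _ ≤ t ^ (1 / 2 : ℝ) * a t := by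
        gcongr
  have hbase : t⁻¹ ^ N * (p⁻¹ ^ N * (a t)⁻¹ ^ (2 * N)) = y⁻¹ ^ (2 * N) := by
    rw [pow_mul, pow_mul, inv_pow y, ← mul_rpow_mul_sq_eq ht, ← hpd, ← mul_pow, ← mul_pow]
    congr 1
    simp only [mul_inv, inv_pow]
    ring
  have hfinal : t ^ (4 : ℝ) ≤ y ^ (2 * N - n) := by
    calc t ^ (4 : ℝ) ≤ t ^ (γ * (2 * (N : ℝ) - n)) :=
          Real.rpow_le_rpow_of_exponent_le ht1 hN
      _ = (t ^ γ) ^ (2 * N - n) := by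
          rw [Real.rpow_mul ht.le, ← Real.rpow_natCast, Nat.cast_sub hnN]
          push_cast
          rfl
      _ ≤ y ^ (2 * N - n) := by gcongr
  have hyn : t ^ (4 : ℝ) * y⁻¹ ^ (2 * N) ≤ y⁻¹ ^ n := by
    have e : y ^ (2 * N - n) * y⁻¹ ^ (2 * N) = y⁻¹ ^ n := by
      rw [show y⁻¹ ^ (2 * N) = y⁻¹ ^ (2 * N - n) * y⁻¹ ^ n by rw [← pow_add]; congr 1; omega,
        ← mul_assoc, ← mul_pow, mul_inv_cancel₀ hy0.ne', one_pow, one_mul]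
    rw [← e]
    gcongr
  have ht4 : t * t * t ^ (1 / 2 : ℝ) ≤ t ^ (-(1 / 2) : ℝ) * t ^ (4 : ℝ) := by
    rw [← Real.rpow_add ht]
    calc t * t * t ^ (1 / 2 : ℝ) = t ^ ((1 : ℝ) + 1 + 1 / 2) := by
          rw [Real.rpow_add ht, Real.rpow_add ht, Real.rpow_one]
      _ ≤ _ := Real.rpow_le_rpow_of_exponent_le ht1 (by norm_num)
  calc K * t⁻¹ ^ N * x ^ (-(1 / 2) : ℝ) * x⁻¹ ^ N * (a t)⁻¹ ^ (2 * N + 1)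
      ≤ K * t⁻¹ ^ N * (4 * L * p⁻¹) * (4 * L * p⁻¹) ^ N * (a t)⁻¹ ^ (2 * N + 1) := by
        have := hxr.trans hxi
        gcongr
    _ = (K * 4 ^ (N + 1) * L ^ (N + 1)) * p⁻¹ * (a t)⁻¹
          * (t⁻¹ ^ N * (p⁻¹ ^ N * (a t)⁻¹ ^ (2 * N))) := by ring
    _ ≤ t * t * t ^ (1 / 2 : ℝ) * y⁻¹ ^ (2 * N) := by rw [hbase]; gcongr
    _ ≤ (t ^ (-(1 / 2) : ℝ) * t ^ (4 : ℝ)) * y⁻¹ ^ (2 * N) := by gcongr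
    _ = t ^ (-(1 / 2) : ℝ) * (t ^ (4 : ℝ) * y⁻¹ ^ (2 * N)) := mul_assoc _ _ _
    _ ≤ _ := by gcongr

theorem eventually_le_err₁ {δ : ℝ} {m : ℕ} (hm : 4 ≤ m) {a : ℝ → ℝ}
    (ha : ∀ᶠ t in atTop, 0 < a t)
    (hO : a =O[atTop] (fun t : ℝ => t ^ (-(δ / 2) + δ / (4 * (m : ℝ) - 2)))) (M : ℝ)
    (hM : 0 ≤ M) :
    ∀ᶠ t in atTop, M * (t ^ (-(1 / 2) : ℝ) * (a t * t ^ (δ / 2))⁻¹ ^ (2 * m - 3))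
      ≤ err₁ δ m t (a t) := by
  obtain ⟨c, hc0, hc⟩ := hO.exists_pos
  filter_upwards [ha, hc.bound, eventually_gt_atTop 0,
    Real.tendsto_log_atTop.eventually_ge_atTop (max 1 (M * c ^ (2 * m - 1)))] with t hat hct ht hL
  have hL1 : 1 ≤ Real.log t := (le_max_left _ _).trans hL
  have hL2 : M * c ^ (2 * m - 1) ≤ Real.log t := (le_max_right _ _).trans hL
  rw [Real.norm_of_nonneg hat.le, Real.norm_of_nonneg (by positivity)] at hct
  set y := a t * t ^ (δ / 2) with hyd
  have hy0 : 0 < y := by positivity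
  have hm' : (4 : ℝ) ≤ m := by exact_mod_cast hm
  have hy : y ≤ c * t ^ (δ / (4 * (m : ℝ) - 2)) := by
    calc y ≤ c * t ^ (-(δ / 2) + δ / (4 * (m : ℝ) - 2)) * t ^ (δ / 2) := by rw [hyd]; gcongr
      _ = _ := by rw [mul_assoc, ← Real.rpow_add ht]; congr 2; ring
  have hyp : y ^ (2 * m - 1) ≤ c ^ (2 * m - 1) * t ^ (δ / 2) := by
    calc y ^ (2 * m - 1) ≤ (c * t ^ (δ / (4 * (m : ℝ) - 2))) ^ (2 * m - 1) := by gcongr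
      _ = _ := by
        rw [mul_pow, ← Real.rpow_natCast (t ^ _), ← Real.rpow_mul ht.le, Nat.cast_sub (by omega)]
        congr 2
        push_cast
        have : 4 * (m : ℝ) - 2 ≠ 0 := by linarith
        field_simp
        ring
  have hLp : Real.log t ≤ Real.log t ^ ((4 * (m : ℝ) - 3) / 2) := by
    calc Real.log t = Real.log t ^ (1 : ℝ) := (Real.rpow_one _).symm
      _ ≤ _ := Real.rpow_le_rpow_of_exponent_le hL1 (by linarith)
  have hdd : (1 : ℝ) ≤ (Nat.doubleFactorial (4 * m - 5) : ℝ) := by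
    exact_mod_cast Nat.doubleFactorial_pos _
  rw [err₁_eq ht hat (by omega), ← hyd]
  -- The traded factor `y^(2m-1)` is `O(t^(δ/2))`, and its constant together with `M` is swallowed
  -- by the logarithm.
  have e : y⁻¹ ^ (2 * m - 3) = y ^ (2 * m - 1) * y⁻¹ ^ (4 * m - 4) := by
    rw [show 4 * m - 4 = (2 * m - 1) + (2 * m - 3) by omega, pow_add, ← mul_assoc, ← mul_pow,
      mul_inv_cancel₀ hy0.ne', one_pow, one_mul]
  calc M * (t ^ (-(1 / 2) : ℝ) * y⁻¹ ^ (2 * m - 3))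
      ≤ M * (t ^ (-(1 / 2) : ℝ) * ((c ^ (2 * m - 1) * t ^ (δ / 2)) * y⁻¹ ^ (4 * m - 4))) := by
        rw [e]; gcongr
    _ = (t ^ (-(1 / 2) : ℝ) * t ^ (δ / 2) * y⁻¹ ^ (4 * m - 4)) * (M * c ^ (2 * m - 1)) := by ring
    _ ≤ (t ^ (-(1 / 2) : ℝ) * t ^ (δ / 2) * y⁻¹ ^ (4 * m - 4))
        * Real.log t ^ ((4 * (m : ℝ) - 3) / 2) := by
        gcongr
        exact hL2.trans hLp
    _ ≤ (Nat.doubleFactorial (4 * m - 5) : ℝ)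
        * (t ^ (-(1 / 2) : ℝ) * t ^ (δ / 2) * y⁻¹ ^ (4 * m - 4))
        * Real.log t ^ ((4 * (m : ℝ) - 3) / 2) := by
        refine mul_le_mul_of_nonneg_right ?_ (by positivity)
        exact le_mul_of_one_le_left (by positivity) hdd

theorem tendsto_zero_of_isBigO {δ : ℝ} (hδ0 : 0 < δ) {m : ℕ} (hm : 4 ≤ m) {a : ℝ → ℝ}
    (hO : a =O[atTop] (fun t : ℝ => t ^ (-(δ / 2) + δ / (4 * (m : ℝ) - 2)))) :
    Tendsto a atTop (nhds 0) := by
  refine hO.trans_tendsto ?_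
  have hm' : (4 : ℝ) ≤ m := by exact_mod_cast hm
  have h1 : δ / (4 * (m : ℝ) - 2) < δ / 2 := div_lt_div_of_pos_left hδ0 two_pos (by linarith)
  have := tendsto_rpow_neg_atTop (show 0 < δ / 2 - δ / (4 * (m : ℝ) - 2) by linarith)
  refine this.congr fun t => ?_
  congr 1
  ring

/-- The spare factor `t^ε` absorbs the implied constant of the lower bound on `a`. -/
theorem eventually_rpow_le_mul {δ ε γ : ℝ} (hε : 0 < ε) {a : ℝ → ℝ}
    (ha : ∀ᶠ t in atTop, 0 < a t) (hO : (fun t : ℝ => t ^ (ε - δ / 2 + γ)) =O[atTop] a) :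
    ∀ᶠ t in atTop, t ^ γ ≤ a t * t ^ (δ / 2) := by
  obtain ⟨c, hc0, hc⟩ := hO.exists_pos
  filter_upwards [ha, hc.bound, eventually_gt_atTop 0,
    (tendsto_rpow_atTop hε).eventually_ge_atTop c] with t hat hct ht hct'
  rw [Real.norm_of_nonneg hat.le, Real.norm_of_nonneg (by positivity)] at hct
  have h1 : t ^ (ε - δ / 2 + γ) * t ^ (δ / 2) = t ^ ε * t ^ γ := by
    rw [← Real.rpow_add ht, ← Real.rpow_add ht]; congr 1; ring
  have h2 : c * t ^ γ ≤ c * (a t * t ^ (δ / 2)) := by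
    calc c * t ^ γ ≤ t ^ ε * t ^ γ := by gcongr
      _ = t ^ (ε - δ / 2 + γ) * t ^ (δ / 2) := h1.symm
      _ ≤ c * a t * t ^ (δ / 2) := by gcongr
      _ = _ := mul_assoc _ _ _
  exact le_of_mul_le_mul_left h2 hc0

end JBAsymptotics

/-! ### Assembly of the segment and the tail -/

theorem theorem2 (δ : ℝ) (hδ0 : 0 < δ) (hδ1 : δ < 1) :
    ∃ C : ℝ, 0 < C ∧
      ∀ (m : ℕ), 4 ≤ m →
      ∀ (ε : ℝ), 0 < ε →
      ∀ (a : ℝ → ℝ), (∀ᶠ t in atTop, 0 < a t) →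
        (fun t : ℝ => t ^ (ε - δ / 2 + δ / (4 * (m : ℝ) + 2))) =O[atTop] a →
        a =O[atTop] (fun t : ℝ => t ^ (-(δ / 2) + δ / (4 * (m : ℝ) - 2))) →
        ∀ᶠ t in atTop, ∀ lam : ℝ,
          t ^ (δ - 1) / (1 - t ^ (δ - 1)) ≤ lam → lam ≤ t ^ (1 - δ) - 1 →
          (∀ φ : ℝ, JBAsymptotics.AdmissibleAngle lam φ →
            IntegrableOn (JBAsymptotics.rayIntegrand δ (1 / 2) t lam φ) (Set.Ioi 0) ∧
            ‖JBAsymptotics.JB δ (1 / 2) t lam φ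
                - (∑ j ∈ Finset.range (m - 2),
                    JBAsymptotics.T t lam (JBAsymptotics.splitK δ t (a t)) j)
                - JBAsymptotics.fresnelTerm δ t lam (a t)‖
              ≤ C * (JBAsymptotics.err₁ δ m t (a t) + JBAsymptotics.err₂ δ t (a t))) ∧
          (∀ j ∈ Finset.range (m - 2),
            ‖JBAsymptotics.T t lam (JBAsymptotics.splitK δ t (a t)) j‖
              ≤ C * JBAsymptotics.boundT δ j t (a t)) := by
  open JBAsymptotics in
  refine ⟨9, by norm_num, fun m hm ε hε a ha hlow hup => ?_⟩
  have ha0 := tendsto_zero_of_isBigO hδ0 hm hup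
  set γ := δ / (4 * (m : ℝ) + 2) with hγd
  have hγ : 0 < γ := by positivity
  have hy := eventually_rpow_le_mul hε ha hlow
  -- With `N = m + r` the surplus exponent is `2N - (2m-3) = 2r + 3`, so `γ r ≥ 4` suffices.
  obtain ⟨r, hr⟩ := exists_nat_ge (4 / γ)
  set N := m + r with hN
  obtain ⟨K, hK0, hK⟩ := exists_norm_tail_le N
  have hNγ : 4 ≤ γ * (2 * (N : ℝ) - (2 * m - 3 : ℕ)) := by
    rw [div_le_iff₀ hγ] at hr
    rw [hN, Nat.cast_sub (by omega)]
    push_cast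
    nlinarith [Nat.cast_nonneg (α := ℝ) r]
  set M : ℝ := ∑ j ∈ Finset.Ico (m - 2) N, 2 * (Nat.doubleFactorial (2 * j - 1) : ℝ) with hM
  have hM0 : 0 ≤ M := Finset.sum_nonneg fun j _ => by positivity
  filter_upwards [ha, ha0.eventually_le_const (show (0 : ℝ) < 1 / 2 by norm_num),
    (tendsto_rpow_sub_one hδ1).eventually_le_const (show (0 : ℝ) < 1 / 2 by norm_num),
    eventually_ge_atTop 2, Real.tendsto_log_atTop.eventually_ge_atTop 1, hy,
    (Filter.eventually_all_finset (Finset.range N)).2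
      fun j _ => eventually_norm_T_le (δ := δ) hδ1 ha ha0 j,
    eventually_remainder_le hδ1 hδ0 hγ ha ha0 hy K hK0 (2 * m - 3) N hNγ (by omega),
    -- `M` pays for the boundary terms with `m - 2 ≤ j < N`, and `1` for the remainder.
    eventually_le_err₁ hm ha hup (M + 1) (by linarith)]
    with t hat hat1 hp1 ht2 hL hyt hT hrem herr lam hlam _
  have ht : 0 < t := by linarith
  have hp0 : 0 < t ^ (δ - 1) := Real.rpow_pos_of_pos ht _
  have hlam0 : 0 < lam := (div_pos hp0 (by linarith)).trans_le hlam
  have hy1 : 1 ≤ a t * t ^ (δ / 2) :=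
    (Real.one_le_rpow (by linarith) hγ.le).trans hyt
  have herr1 : 0 ≤ err₁ δ m t (a t) := le_trans (by positivity) herr
  have herr2 : 0 ≤ err₂ δ t (a t) := by rw [err₂]; positivity
  have hz0 : z₀ δ t = 1 - t ^ (δ - 1) := rfl
  set k := splitK δ t (a t) with hk
  have hk0 : 0 < k := splitK_pos hp0 hat1
  have hk1 : k ≤ 1 / 2 := splitK_le hp0 hp1 hat
  set η := (Real.log t)⁻¹ with hη
  have hη0 : 0 < η := by positivity
  have hη1 : η ≤ 1 := inv_le_one_of_one_le₀ hL
  -- The slope `1 / ln t` is dictated by `ln λ ≥ ln λ_c ≥ (δ-1) ln t ≥ -ln t`.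
  have hηlam : -1 ≤ η * Real.log lam := by
    have h1 := log_lamC_le hp0 hp1 hlam
    have h2 := Real.log_nonpos (show 0 ≤ 1 - t ^ (δ - 1) by linarith) (by linarith)
    rw [Real.log_rpow ht] at h1
    have h3 : -Real.log t ≤ Real.log lam := by nlinarith
    have h4 := mul_le_mul_of_nonneg_left h3 hη0.le
    rwa [mul_neg, hη, inv_mul_cancel₀ (by linarith)] at h4
  have hb := le_log_splitK hp0 hp1 hat hat1 hlam
  refine ⟨fun φ hφ => ⟨integrableOn_rayIntegrand ht (by linarith) (by linarith) hφ, ?_⟩,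
    fun j hj => ?_⟩
  · obtain ⟨g, hg1, hg2, hg3⟩ := exists_primitive_tendsto (δ := δ) ht (by linarith) (by linarith)
      hφ hk0 (by linarith) hη0 (show 0 < Real.pi + η * Real.log lam by linarith [Real.pi_gt_three])
    have htail := (hK t lam k η (a t) ht2 hk0 hk1 hη0 hη1 hηlam hat (by linarith) hb g _ hg2
      hg3).trans hrem
    have hnear := norm_near_sub_fresnelTerm_le (lam := lam) ht rfl hp1 hlam0 hat hat1
      (by rw [mul_rpow_mul_sq_eq ht]; exact one_le_pow₀ hy1) hg1
    rw [← err₂_eq ht, ← hz0, show z₀ δ t + t ^ (δ - 1) * a t = 1 - k by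
      rw [hz0, hk, splitK]; ring] at hnear
    have hmid : ‖∑ j ∈ Finset.Ico (m - 2) N, T t lam k j‖
        ≤ M * (t ^ (-(1 / 2) : ℝ) * (a t * t ^ (δ / 2))⁻¹ ^ (2 * m - 3)) := by
      rw [hM, Finset.sum_mul]
      refine (norm_sum_le _ _).trans (Finset.sum_le_sum fun j hj => ?_)
      rw [Finset.mem_Ico] at hj
      refine (hT j (Finset.mem_range.2 hj.2) lam hlam).trans ?_
      rw [boundT_eq ht hat, ← mul_assoc]
      gcongr ?_ * (_ * ?_)
      exact pow_le_pow_of_le_one (by positivity) (inv_le_one_of_one_le₀ hy1) (by omega)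
    have hsplit := Finset.sum_range_add_sum_Ico (fun j => T t lam k j) (show m - 2 ≤ N by omega)
    have e : JB δ (1 / 2) t lam φ - (∑ j ∈ Finset.range (m - 2), T t lam k j)
        - fresnelTerm δ t lam (a t)
        = (g (z₀ δ t) + JB δ (1 / 2) t lam φ - g ((1 - k : ℝ) : ℂ)
            - ∑ j ∈ Finset.range N, T t lam k j)
          + ∑ j ∈ Finset.Ico (m - 2) N, T t lam k j
          + (g ((1 - k : ℝ) : ℂ) - g (z₀ δ t) - fresnelTerm δ t lam (a t)) := by
      rw [← hsplit]; ring
    rw [e]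
    refine (norm_add₃_le).trans ?_
    nlinarith
  · have hj' := Finset.mem_range.1 hj
    have hB : 0 ≤ boundT δ j t (a t) := by rw [boundT]; positivity
    have := hT j (Finset.mem_range.2 (by omega)) lam hlam
    linarith
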